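/- Let $a_n, b_m, c_k, d_l$ ($n,m,k,l\in\mathbb{Z}$) be real sequences with $c_k\neq0$ and $d_l\neq 0$ for all $k,l$, and let $p_i,\alpha_i,\beta_i\in\mathbb{C}$ ($i\ge 1$). Sums $\sum_{j}^{n-1}$ and products $\prod_j^{n-1}$ over an integer index $n\in\mathbb{Z}$ are indefinite: they take the values $0$ and $1$ at $n=0$, and passing from $n$ to $n+1$ adds (multiplies by) the term with index $n$. For $N\ge 0$ and $x,t,y\in\mathbb{R}$ put $$\tau_n^m(x,t;y;k,l,N)=\exp\Big[-\Big(x+\sum_{n'}^{n-1}a_{n'}+\sum_{m'}^{m-1}b_{m'}+\sum_{k'}^{k-1}c_{k'}+\sum_{l'}^{l-1}\tfrac1{d_{l'}}\Big)y\Big]\det\big(f^{(i)}_{j-1}\big)_{i,j=1,\dots,N},$$ $$f_s^{(i)}=E_s(\alpha_i,p_i)+E_s(\beta_i,-p_i),$$ $$E_s(A,q)=A\,q^s\prod_{n'}^{n-1}(1-a_{n'}q)^{-1}\prod_{m'}^{m-1}(1-b_{m'}q)^{-1}\prod_{k'}^{k-1}(1-c_{k'}q)^{-1}\prod_{l'}^{l-1}\Big(1-\frac{d_{l'}}{q}\Big)^{-1}e^{qx-4q^3t+y/q},$$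 where the determinant is $1$ for $N=0$. Assume that for $i=1,\dots,N$ one has $p_i\ne0$ and all denominators are nonzero, that is, $1\pm a_np_i$, $1\pm b_mp_i$, $1\pm c_kp_i$, $1\pm d_l/p_i$ are nonzero for all $n,m,k,l$. Assume that the parameters are either of soliton type, $p_i,\alpha_i\in\mathbb{R}$, $\beta_i\in\sqrt{-1}\,\mathbb{R}$ for $i=1,\dots,N$, or of breather type, $N=2M$ and $p_{2j}=p_{2j-1}^*$, $\alpha_{2j}=\alpha_{2j-1}^*$, $\beta_{2j}=-\beta_{2j-1}^*$ for $j=1,\dots,M$. Let $\Theta_n^m=\frac{2}{\sqrt{-1}}\log\frac{\tau_n^m}{(\tau_n^m)^*}$ be the real potential function, considered only where $\tau_n^m\neq0$; as a function of $(x,t)$ it is any continuous branch $\theta(x,t)$ on an open set $U\subset\mathbb{R}^2$ (with $n,m,y$ fixed), and as a function of $(n,m)$ it is any branch on a set $S\subset\mathbb{Z}^2$ (with $x,t,y$ fixed). The statements below hold on every $U$, respectively $S$, on which both potentials involved are defined; lattice equations are meant at all $(n,m)$ for which all sites occurring lie in $S$. An equation $\tan A=\frac{\mu+\varepsilon}{\mu-\varepsilon}\tan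 B$ is understood also in the form $(\mu-\varepsilon)\sin A\cos B=(\mu+\varepsilon)\cos A\sin B$, which gives its meaning when a tangent is infinite or $\mu=\varepsilon$. Potential mKdV equation: $\theta_t+\frac12(\theta_x)^3+\theta_{xxx}=0$. Discrete potential mKdV equation: $$\tan\frac{\Theta_{n+1}^{m+1}-\Theta_n^m}{4}=\frac{b_m+a_n}{b_m-a_n}\tan\frac{\Theta_n^{m+1}-\Theta_{n+1}^m}{4}.$$ Consider, for $\lambda\neq0$, the systems (A) $\displaystyle\Big(\frac{\widetilde\theta+\theta}{2}\Big)_x=2\lambda\sin\frac{\widetilde\theta-\theta}{2},\quad \Big(\frac{\widetilde\theta+\theta}{2}\Big)_t=-\lambda\{(\theta_x)^2+8\lambda^2\}\sin\frac{\widetilde\theta-\theta}{2}+2\lambda\theta_{xx}\cos\frac{\widetilde\theta-\theta}{2}+4\lambda^2\theta_x;$ (B) $\displaystyle\tan\frac{\widetilde\Theta_{n+1}^m-\Theta_n^m}{4}=\frac{\frac1\lambda+a_n}{\frac1\lambda-a_n}\tan\frac{\widetilde\Theta_n^m-\Theta_{n+1}^m}{4},\quad \tan\frac{\widetilde\Theta_{n}^{m+1}-\Theta_n^m}{4}=\frac{\frac1\lambda+b_m}{\frac1\lambda-b_m}\tan\frac{\widetilde\Theta_n^m-\Theta_{n}^{m+1}}{4};$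 (C) $\displaystyle\Big(\frac{\overline\theta-\theta}{2}\Big)_x=2\lambda\sin\frac{\overline\theta+\theta}{2},\quad \Big(\frac{\overline\theta-\theta}{2}\Big)_t=-\lambda\{(\theta_x)^2+8\lambda^2\}\sin\frac{\overline\theta+\theta}{2}-2\lambda\theta_{xx}\cos\frac{\overline\theta+\theta}{2}-4\lambda^2\theta_x;$ (D) $\displaystyle\tan\frac{\overline\Theta{}_{n+1}^m+\Theta_n^m}{4}=\frac{\frac1\lambda+a_n}{\frac1\lambda-a_n}\tan\frac{\overline\Theta{}_n^m+\Theta_{n+1}^m}{4},\quad \tan\frac{\overline\Theta{}_{n}^{m+1}+\Theta_n^m}{4}=\frac{\frac1\lambda+b_m}{\frac1\lambda-b_m}\tan\frac{\overline\Theta{}_n^m+\Theta_{n}^{m+1}}{4}.$ Then in each case below the old and the new potential are solutions (smooth ones in the continuous cases) of the potential mKdV equation, respectively of the discrete potential mKdV equation, $\lambda\ne0$, and the following holds. 1. For any $k\in\mathbb{Z}$, $\widetilde\theta=\theta(\cdot;k+1)$ is a Bäcklund transform of $\theta=\theta(\cdot;k)$, related by (A) with $\lambda=1/c_k$. 2.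 For any $k\in\mathbb{Z}$, $\widetilde\Theta=\Theta(k+1)$ is a Bäcklund transform of $\Theta=\Theta(k)$, related by (B) with $\lambda=1/c_k$. 3. If the parameters with index $N+1$ also satisfy $p_{N+1},\alpha_{N+1}\in\mathbb{R}$, $\beta_{N+1}\in\sqrt{-1}\,\mathbb{R}$ and the same non-vanishing conditions, then $\widetilde\theta=\theta(\cdot;N+1)$ is a Bäcklund transform of $\theta=\theta(\cdot;N)$, related by (A) with $\lambda=-p_{N+1}$. 4. Under the same assumption, $\widetilde\Theta=\Theta(N+1)$ is a Bäcklund transform of $\Theta=\Theta(N)$, related by (B) with $\lambda=-p_{N+1}$. 5. For any $l\in\mathbb{Z}$, $\overline\theta=\theta(\cdot;l+1)$ is a Bäcklund transform of $\theta=\theta(\cdot;l)$, related by (C) with $\lambda=d_l$. 6. For any $l\in\mathbb{Z}$, $\overline\Theta=\Theta(l+1)$ is a Bäcklund transform of $\Theta=\Theta(l)$, related by (D) with $\lambda=d_l$. In each case, the variables among $k,l,N$ that are not shifted are arbitrary and fixed. -/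

import Mathlib

open scoped ComplexConjugate

/-- The indefinite sum `∑_{j}^{n-1} u_j` over the integers, normalised to vanish at `n = 0`:
it satisfies `indefSum u (n+1) = indefSum u n + u n` for all `n : ℤ`. -/
noncomputable def indefSum (u : ℤ → ℝ) (n : ℤ) : ℝ :=
  (∑ j ∈ Finset.Ico 0 n, u j) - ∑ j ∈ Finset.Ico n 0, u j

/-- The indefinite product `∏_{j}^{n-1} u_j` over the integers, normalised to be `1` at `n = 0`:
it satisfies `indefProd u (n+1) = indefProd u n * u n` for all `n : ℤ` if no `u j` vanishes. -/
noncomputable def indefProd (u : ℤ → ℂ) (n : ℤ) : ℂ :=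
  (∏ j ∈ Finset.Ico 0 n, u j) / ∏ j ∈ Finset.Ico n 0, u j

/-- The data of the tau function: the lattice parameters `a_n, b_m, c_k, d_l` and the
spectral and phase parameters `p_i, α_i, β_i`, of which only the indices `i ≥ 1` are used. -/
structure TauData where
  a : ℤ → ℝ
  b : ℤ → ℝ
  c : ℤ → ℝ
  d : ℤ → ℝ
  p : ℕ → ℂ
  α : ℕ → ℂ
  β : ℕ → ℂ

namespace TauData

/-- The exponential `A q^s ∏(1 - a q)⁻¹ ∏(1 - b q)⁻¹ ∏(1 - c q)⁻¹ ∏(1 - d/q)⁻¹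
exp(q x - 4 q³ t + y / q)`. With `(A, q) = (α_i, p_i)` this is `e^{η_i}`, and with
`(A, q) = (β_i, -p_i)` it is `e^{μ_i}`. -/
noncomputable def expTerm (P : TauData) (A q : ℂ) (s : ℤ) (k l n m : ℤ) (x t y : ℝ) : ℂ :=
  A * q ^ s
    * indefProd (fun j => (1 - (P.a j : ℂ) * q)⁻¹) n
    * indefProd (fun j => (1 - (P.b j : ℂ) * q)⁻¹) m
    * indefProd (fun j => (1 - (P.c j : ℂ) * q)⁻¹) k
    * indefProd (fun j => (1 - (P.d j : ℂ) / q)⁻¹) l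
    * Complex.exp (q * x - 4 * q ^ 3 * t + 1 / q * y)

/-- The entry `f_s^{(i)} = e^{η_i} + e^{μ_i}`. -/
noncomputable def entry (P : TauData) (i : ℕ) (s : ℤ) (k l n m : ℤ) (x t y : ℝ) : ℂ :=
  P.expTerm (P.α i) (P.p i) s k l n m x t y + P.expTerm (P.β i) (-P.p i) s k l n m x t y

/-- The tau function `τ_n^m(x,t;y;k,l,N)`: an exponential prefactor times
`det (f_{j-1}^{(i)})_{i,j=1,…,N}` (the determinant is `1` for `N = 0`). -/
noncomputable def tau (P : TauData) (N : ℕ) (k l n m : ℤ) (x t y : ℝ) : ℂ :=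
  Complex.exp (((-(x + indefSum P.a n + indefSum P.b m + indefSum P.c k
      + indefSum (fun j => 1 / P.d j) l) * y : ℝ) : ℂ))
    * Matrix.det (Matrix.of fun i j : Fin N => P.entry (i.val + 1) (j.val : ℤ) k l n m x t y)

/-- The soliton reality condition for the index `i`: `p_i, α_i ∈ ℝ`, `β_i ∈ √-1 ℝ`. -/
def SolitonAt (P : TauData) (i : ℕ) : Prop :=
  (P.p i).im = 0 ∧ (P.α i).im = 0 ∧ (P.β i).re = 0

/-- `N`-soliton parameters. -/
def SolitonParams (P : TauData) (N : ℕ) : Prop :=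
  ∀ i, 1 ≤ i → i ≤ N → P.SolitonAt i

/-- Breather parameters: `N = 2M`, `p_{2j} = p_{2j-1}^*`, `α_{2j} = α_{2j-1}^*`,
`β_{2j} = -β_{2j-1}^*` for `j = 1, …, M`. -/
def BreatherParams (P : TauData) (N : ℕ) : Prop :=
  ∃ M : ℕ, N = 2 * M ∧ ∀ j, 1 ≤ j → j ≤ M →
    P.p (2 * j) = conj (P.p (2 * j - 1)) ∧ P.α (2 * j) = conj (P.α (2 * j - 1)) ∧
      P.β (2 * j) = -conj (P.β (2 * j - 1))

/-- All denominators that occur in `f_s^{(i)}` are non-zero. -/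
def RegularAt (P : TauData) (i : ℕ) : Prop :=
  P.p i ≠ 0 ∧
    (∀ j, 1 - (P.a j : ℂ) * P.p i ≠ 0 ∧ 1 + (P.a j : ℂ) * P.p i ≠ 0) ∧
    (∀ j, 1 - (P.b j : ℂ) * P.p i ≠ 0 ∧ 1 + (P.b j : ℂ) * P.p i ≠ 0) ∧
    (∀ j, 1 - (P.c j : ℂ) * P.p i ≠ 0 ∧ 1 + (P.c j : ℂ) * P.p i ≠ 0) ∧
    (∀ j, 1 - (P.d j : ℂ) / P.p i ≠ 0 ∧ 1 + (P.d j : ℂ) / P.p i ≠ 0)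

end TauData

/-- `θ` is one of the values of `(2 / √-1) log (z / z^*)`, `z ≠ 0`. -/
def IsPotentialValue (z : ℂ) (θ : ℝ) : Prop :=
  z ≠ 0 ∧ Complex.exp (Complex.I * θ / 2) = z / conj z

/-- `θ(x,t)` is a continuous branch of `(2 / √-1) log (τ / τ^*)` on the set `U` of the
`(x,t)`-plane (in particular `τ` has no zero there). -/
def IsPotentialOn (U : Set (ℝ × ℝ)) (τ : ℝ → ℝ → ℂ) (θ : ℝ → ℝ → ℝ) : Prop :=
  ContinuousOn (fun q : ℝ × ℝ => θ q.1 q.2) U ∧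
    ∀ x t, (x, t) ∈ U → IsPotentialValue (τ x t) (θ x t)

/-- `Θ_n^m` is a branch of `(2 / √-1) log (τ_n^m / (τ_n^m)^*)` at the sites `(n,m) ∈ S`. -/
def IsLatticePotentialOn (S : Set (ℤ × ℤ)) (τ : ℤ → ℤ → ℂ) (Θ : ℤ → ℤ → ℝ) : Prop :=
  ∀ n m, (n, m) ∈ S → IsPotentialValue (τ n m) (Θ n m)

/-- `∂θ/∂x`. -/
noncomputable def dX (θ : ℝ → ℝ → ℝ) (x t : ℝ) : ℝ := deriv (fun x' => θ x' t) x

/-- `∂θ/∂t`. -/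
noncomputable def dT (θ : ℝ → ℝ → ℝ) (x t : ℝ) : ℝ := deriv (fun t' => θ x t') t

/-- `θ` is a smooth solution of `θ_t + (θ_x)³ / 2 + θ_xxx = 0` on `U`. -/
def SolvesPmKdV (U : Set (ℝ × ℝ)) (θ : ℝ → ℝ → ℝ) : Prop :=
  ContDiffOn ℝ ((⊤ : ℕ∞) : WithTop ℕ∞) (fun q : ℝ × ℝ => θ q.1 q.2) U ∧
    ∀ x t, (x, t) ∈ U → dT θ x t + 1 / 2 * (dX θ x t) ^ 3 + dX (dX (dX θ)) x t = 0

/-- `θ'` is a Bäcklund transform of the solution `θ` of the potential mKdV equation. -/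
structure PmKdVBacklund (U : Set (ℝ × ℝ)) (lam : ℝ) (θ θ' : ℝ → ℝ → ℝ) : Prop where
  lam_ne : lam ≠ 0
  solves : SolvesPmKdV U θ
  solves' : SolvesPmKdV U θ'
  eq_x : ∀ x t, (x, t) ∈ U →
    dX (fun x t => (θ' x t + θ x t) / 2) x t = 2 * lam * Real.sin ((θ' x t - θ x t) / 2)
  eq_t : ∀ x t, (x, t) ∈ U →
    dT (fun x t => (θ' x t + θ x t) / 2) x t =
      -lam * ((dX θ x t) ^ 2 + 8 * lam ^ 2) * Real.sin ((θ' x t - θ x t) / 2)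
        + 2 * lam * dX (dX θ) x t * Real.cos ((θ' x t - θ x t) / 2)
        + 4 * lam ^ 2 * dX θ x t

/-- The second kind of Bäcklund transform of a solution of the potential mKdV equation. -/
structure PmKdVBacklundBar (U : Set (ℝ × ℝ)) (lam : ℝ) (θ θ' : ℝ → ℝ → ℝ) : Prop where
  lam_ne : lam ≠ 0
  solves : SolvesPmKdV U θ
  solves' : SolvesPmKdV U θ'
  eq_x : ∀ x t, (x, t) ∈ U →
    dX (fun x t => (θ' x t - θ x t) / 2) x t = 2 * lam * Real.sin ((θ' x t + θ x t) / 2)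
  eq_t : ∀ x t, (x, t) ∈ U →
    dT (fun x t => (θ' x t - θ x t) / 2) x t =
      -lam * ((dX θ x t) ^ 2 + 8 * lam ^ 2) * Real.sin ((θ' x t + θ x t) / 2)
        - 2 * lam * dX (dX θ) x t * Real.cos ((θ' x t + θ x t) / 2)
        - 4 * lam ^ 2 * dX θ x t

/-- The equation `tan A = (μ + ε) / (μ - ε) * tan B`. It is stated as written when `μ ≠ ε`, and
in addition with denominators cleared, which is its meaning when a tangent is infinite
or `μ = ε`. -/
def TanEq (μ ε A B : ℝ) : Prop :=
  (μ - ε) * (Real.sin A * Real.cos B) = (μ + ε) * (Real.cos A * Real.sin B) ∧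
    (μ ≠ ε → Real.tan A = (μ + ε) / (μ - ε) * Real.tan B)

/-- `Θ` solves the discrete potential mKdV equation on every elementary square inside `S`. -/
def SolvesDpmKdV (S : Set (ℤ × ℤ)) (a b : ℤ → ℝ) (Θ : ℤ → ℤ → ℝ) : Prop :=
  ∀ n m, (n, m) ∈ S → (n + 1, m) ∈ S → (n, m + 1) ∈ S → (n + 1, m + 1) ∈ S →
    TanEq (b m) (a n) ((Θ (n + 1) (m + 1) - Θ n m) / 4) ((Θ n (m + 1) - Θ (n + 1) m) / 4)

/-- `Θ'` is a Bäcklund transform of the solution `Θ` of the discrete potential mKdV equation. -/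
structure DpmKdVBacklund (S : Set (ℤ × ℤ)) (a b : ℤ → ℝ) (lam : ℝ) (Θ Θ' : ℤ → ℤ → ℝ) :
    Prop where
  lam_ne : lam ≠ 0
  solves : SolvesDpmKdV S a b Θ
  solves' : SolvesDpmKdV S a b Θ'
  eq_n : ∀ n m, (n, m) ∈ S → (n + 1, m) ∈ S →
    TanEq (1 / lam) (a n) ((Θ' (n + 1) m - Θ n m) / 4) ((Θ' n m - Θ (n + 1) m) / 4)
  eq_m : ∀ n m, (n, m) ∈ S → (n, m + 1) ∈ S →
    TanEq (1 / lam) (b m) ((Θ' n (m + 1) - Θ n m) / 4) ((Θ' n m - Θ n (m + 1)) / 4)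

/-- The second kind of Bäcklund transform of a solution of the discrete potential mKdV
equation. -/
structure DpmKdVBacklundBar (S : Set (ℤ × ℤ)) (a b : ℤ → ℝ) (lam : ℝ) (Θ Θ' : ℤ → ℤ → ℝ) :
    Prop where
  lam_ne : lam ≠ 0
  solves : SolvesDpmKdV S a b Θ
  solves' : SolvesDpmKdV S a b Θ'
  eq_n : ∀ n m, (n, m) ∈ S → (n + 1, m) ∈ S →
    TanEq (1 / lam) (a n) ((Θ' (n + 1) m + Θ n m) / 4) ((Θ' n m + Θ (n + 1) m) / 4)
  eq_m : ∀ n m, (n, m) ∈ S → (n, m + 1) ∈ S →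
    TanEq (1 / lam) (b m) ((Θ' n (m + 1) + Θ n m) / 4) ((Θ' n m + Θ n (m + 1)) / 4)

/-! Write D(e, m) for the determinant with entries e_i p_i^j + m_i (-p_i)^j. Under either reality
condition, conjugation permutes the rows and flips the sign of m. So τ* is, up to a sign and a
positive prefactor shared with τ, equal to D(e, -m). Hence r = D(e, -m) / D(e, m) equals ±
exp(-iθ/2) (`IsRealData.isPhase`), and every claim becomes a claim about r.

The ratio sits in the monic polynomial Q of degree N with e_i Q(p_i) + m_i Q(-p_i) = 0 for all i
(`wave`): Q(0) = (-1)^N ∏ p_i · r. Let Q⁻ belong to (e, -m), and let w, w⁻ be the subleading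
coefficients (0 if N = 0). Since X Q⁻ meets the conditions for (e, m), every R of degree at most N +
1 that meets them is a combination of X Q⁻ and Q. Constant terms then give R(0) = (R_N - R_{N+1} w⁻)
Q(0) (`InKer.coeff_zero_eq`).

Everything comes from a choice of R: (1 - cX) Q for data shifted with parameter c, the wave
polynomial of N + 1 rows for an appended row, Q_x + X Q for the x-flow, Q_t + 4X² Q_x for the
t-flow. Eliminating w from the first two kinds of relation around a square gives a quadratic
relation among four ratios, which is the tangent equation (`tanEq_of_phases`). Subtracting a
relation from its companion for -m gives v + v' = λ(r'/r - r/r') with v = (log r)_x, the x-part of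
(A). The flows give r_t = (-v_xx + 2v³) r, which is the potential mKdV equation for θ. The t-part of
(A) follows from the x-part and the two evolution equations (`PmKdVBacklund.of_eq_x`).

For a shift in l, 1 - d/p = -(d/p)(1 - p/d) shows that, up to row factors and the sign of m, it is a
shift with parameter 1/d. Flipping m inverts r and negates the new potential, so (C) and (D) reduce
to (A) and (B). -/

open Polynomial

/-! ### Alternants, wave polynomials and their kernel conditions -/

/-- The entry `e_i p_i^s + m_i (-p_i)^s`. -/
noncomputable def altEntry {N : ℕ} (p e m : Fin N → ℂ) (s : ℕ) (i : Fin N) : ℂ :=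
  e i * p i ^ s + m i * (-p i) ^ s

/-- The alternant `det (e_i p_i^j + m_i (-p_i)^j)`. -/
noncomputable def altDet {N : ℕ} (p e m : Fin N → ℂ) : ℂ :=
  (Matrix.of fun i k : Fin N => altEntry p e m k i).det

/-- The minor of the `N × (N + 1)` alternant with column `j` removed. -/
noncomputable def altMinor {N : ℕ} (p e m : Fin N → ℂ) (j : Fin (N + 1)) : ℂ :=
  (Matrix.of fun i k : Fin N => altEntry p e m (j.succAbove k : Fin (N + 1)) i).det

/-- The coefficients of the wave polynomial. -/
noncomputable def waveCoeff {N : ℕ} (p e m : Fin N → ℂ) (j : Fin (N + 1)) : ℂ :=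
  (altDet p e m)⁻¹ * ((-1) ^ (N + (j : ℕ)) * altMinor p e m j)

/-- The monic polynomial `Q` of degree `N` with `e_i Q(p_i) + m_i Q(-p_i) = 0`. -/
noncomputable def wave {N : ℕ} (p e m : Fin N → ℂ) : ℂ[X] :=
  ∑ j : Fin (N + 1), C (waveCoeff p e m j) * X ^ (j : ℕ)

/-- The polynomials annihilated by the `N` functionals `R ↦ e_i R(p_i) + m_i R(-p_i)`. -/
def InKer {N : ℕ} (p e m : Fin N → ℂ) (R : ℂ[X]) : Prop :=
  ∀ i, e i * R.eval (p i) + m i * R.eval (-p i) = 0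

/-- The subleading coefficient of the wave polynomial. -/
noncomputable def waveSub {N : ℕ} (p e m : Fin N → ℂ) : ℂ := (X * wave p e m).coeff N

section Algebra

variable {N : ℕ} {p e m : Fin N → ℂ}

theorem altMinor_last : altMinor p e m (Fin.last N) = altDet p e m := by
  simp [altMinor, altDet]

theorem altDet_mul_row (κ : Fin N → ℂ) :
    altDet p (fun i => κ i * e i) (fun i => κ i * m i) = (∏ i, κ i) * altDet p e m := by
  unfold altDet
  rw [← Matrix.det_mul_column]
  congr 1
  ext i j
  simp only [Matrix.of_apply, altEntry]
  ring

/-- Without the column of exponent 0 every exponent rises by one; pulling p_i out of row i leaves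
(-p_i)^s with a minus sign, which is absorbed into m. -/
theorem altMinor_zero : altMinor p e m 0 = (∏ i, p i) * altDet p e (-m) := by
  unfold altMinor altDet
  rw [← Matrix.det_mul_column]
  congr 1
  ext i j
  simp only [Matrix.of_apply, altEntry, Fin.zero_succAbove, Fin.val_succ, Pi.neg_apply]
  ring

theorem coeff_wave (n : ℕ) :
    (wave p e m).coeff n = if h : n < N + 1 then waveCoeff p e m ⟨n, h⟩ else 0 := by
  unfold wave
  simp only [finsetSum_coeff, coeff_C_mul, coeff_X_pow, mul_ite, mul_one, mul_zero]
  split_ifs with h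
  · rw [Finset.sum_eq_single ⟨n, h⟩] <;> simp +contextual [Fin.ext_iff, eq_comm]
  · exact Finset.sum_eq_zero fun j _ => if_neg fun hj => h (by omega)

theorem natDegree_wave_le : (wave p e m).natDegree ≤ N :=
  natDegree_le_iff_coeff_eq_zero.2 fun n hn => by
    rw [coeff_wave, dif_neg (by omega)]

theorem coeff_wave_self (h : altDet p e m ≠ 0) : (wave p e m).coeff N = 1 := by
  rw [coeff_wave, dif_pos (Nat.lt_succ_self N)]
  have : (⟨N, Nat.lt_succ_self N⟩ : Fin (N + 1)) = Fin.last N := rfl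
  rw [this, waveCoeff, altMinor_last, Fin.val_last, ← two_mul, pow_mul]
  simp [h]

theorem coeff_wave_zero :
    (wave p e m).coeff 0 = (-1) ^ N * (∏ i, p i) * (altDet p e (-m) / altDet p e m) := by
  rw [coeff_wave, dif_pos (Nat.succ_pos N)]
  have : (⟨0, Nat.succ_pos N⟩ : Fin (N + 1)) = 0 := rfl
  rw [this, waveCoeff, altMinor_zero]
  simp only [Fin.val_zero, add_zero]
  ring

/-- Laplace expansion of a determinant whose top row repeats row i. No nonvanishing is needed: if
the alternant is zero, its inverse is 0 and the wave polynomial is the zero polynomial. -/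
theorem inKer_wave : InKer p e m (wave p e m) := by
  intro i
  let M : Matrix (Fin (N + 1)) (Fin (N + 1)) ℂ :=
    Matrix.of (Fin.cons (fun j : Fin (N + 1) => altEntry p e m j i)
      (fun i' j => altEntry p e m j i'))
  have hM : M.det = 0 := Matrix.det_zero_of_row_eq (Fin.succ_ne_zero i).symm (by
    funext j; simp [M])
  rw [Matrix.det_succ_row_zero] at hM
  have key : e i * (wave p e m).eval (p i) + m i * (wave p e m).eval (-p i) =
      (altDet p e m)⁻¹ * (-1) ^ N * ∑ j : Fin (N + 1),
        (-1) ^ (j : ℕ) * M 0 j * (M.submatrix Fin.succ j.succAbove).det := by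
    simp only [wave, eval_finsetSum, eval_mul, eval_C, eval_pow, eval_X, Finset.mul_sum,
      ← Finset.sum_add_distrib]
    refine Finset.sum_congr rfl fun j _ => ?_
    have h1 : M 0 j = altEntry p e m j i := rfl
    have h2 : (M.submatrix Fin.succ j.succAbove).det = altMinor p e m j := rfl
    rw [h1, h2, waveCoeff, altEntry, pow_add]
    ring
  rw [key, hM, mul_zero]

theorem InKer.add {R S : ℂ[X]} (hR : InKer p e m R) (hS : InKer p e m S) :
    InKer p e m (R + S) := fun i => by
  rw [eval_add, eval_add]
  linear_combination hR i + hS i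

theorem InKer.C_mul {R : ℂ[X]} (hR : InKer p e m R) (c : ℂ) : InKer p e m (C c * R) := fun i => by
  simp only [eval_mul, eval_C]
  linear_combination c * hR i

theorem InKer.sub {R S : ℂ[X]} (hR : InKer p e m R) (hS : InKer p e m S) :
    InKer p e m (R - S) := fun i => by
  rw [eval_sub, eval_sub]
  linear_combination hR i - hS i

theorem InKer.X_sq_mul {R : ℂ[X]} (hR : InKer p e m R) : InKer p e m (X ^ 2 * R) := fun i => by
  simp only [eval_mul, eval_pow, eval_X]
  linear_combination (p i) ^ 2 * hR i

/-- X is odd, so multiplying by it exchanges the conditions for m and -m. This is what couples the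
two wave polynomials. -/
theorem InKer.X_mul {R : ℂ[X]} (hR : InKer p e (-m) R) : InKer p e m (X * R) := fun i => by
  have := hR i
  simp only [Pi.neg_apply] at this
  simp only [eval_mul, eval_X]
  linear_combination (p i) * this

/-- The coefficient vector of a polynomial of degree below N is annihilated by the alternant matrix,
which is invertible. -/
theorem InKer.eq_zero {R : ℂ[X]} (h : altDet p e m ≠ 0) (hR : InKer p e m R)
    (hd : ∀ n, N ≤ n → R.coeff n = 0) : R = 0 := by
  have hdeg : R.degree < N := degree_lt_iff_coeff_zero _ _ |>.2 hd
  have heval : ∀ z, R.eval z = ∑ k : Fin N, R.coeff k * z ^ (k : ℕ) := by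
    intro z
    rw [eval_eq_sum, ← Polynomial.sum_fin (fun n a => a * z ^ n) (by simp) hdeg]
  have hv : (fun k : Fin N => R.coeff k) = 0 := by
    refine Matrix.eq_zero_of_mulVec_eq_zero h ?_
    funext i
    have := hR i
    rw [heval, heval, Finset.mul_sum, Finset.mul_sum, ← Finset.sum_add_distrib] at this
    rw [Pi.zero_apply, ← this]
    simp only [Matrix.mulVec, dotProduct, Matrix.of_apply, altEntry]
    exact Finset.sum_congr rfl fun k _ => by ring
  ext n
  rcases lt_or_ge n N with hn | hn
  · exact congrFun hv ⟨n, hn⟩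
  · simpa using hd n hn

/-- A polynomial of degree at most `N + 1` in the kernel is a combination of the two wave
polynomials. -/
theorem InKer.eq_combination {R : ℂ[X]} (h : altDet p e m ≠ 0) (h' : altDet p e (-m) ≠ 0)
    (hR : InKer p e m R) (hd : R.natDegree ≤ N + 1) :
    R = C (R.coeff (N + 1)) * (X * wave p e (-m)) +
      C (R.coeff N - R.coeff (N + 1) * waveSub p e (-m)) * wave p e m := by
  rw [← sub_eq_zero]
  -- The combination is chosen to cancel the coefficients N and N + 1; higher ones vanish by degree.
  refine InKer.eq_zero h (hR.sub ((inKer_wave.X_mul.C_mul _).add (inKer_wave.C_mul _))) ?_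
  intro n hn
  have hw : ∀ (f g : Fin N → ℂ) n, N < n → (wave p f g).coeff n = 0 := fun f g n hn =>
    coeff_eq_zero_of_natDegree_lt (natDegree_wave_le.trans_lt hn)
  simp only [coeff_sub, coeff_add, coeff_C_mul]
  rcases hn.eq_or_lt with rfl | hn
  · rw [coeff_wave_self h, waveSub]
    ring
  rcases (Nat.succ_le_of_lt hn).eq_or_lt with rfl | hn'
  · rw [coeff_X_mul, coeff_wave_self h', hw _ _ _ hn]
    ring
  · obtain ⟨k, rfl⟩ : ∃ k, n = k + 1 := ⟨n - 1, by omega⟩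
    rw [coeff_X_mul, hw _ _ _ hn, hw _ _ k (by omega),
      coeff_eq_zero_of_natDegree_lt (lt_of_le_of_lt hd (by omega))]
    ring

/-- The summand X Q⁻ has no constant term, so only the multiple of Q is seen at 0. -/
theorem InKer.coeff_zero_eq {R : ℂ[X]} (h : altDet p e m ≠ 0) (h' : altDet p e (-m) ≠ 0)
    (hR : InKer p e m R) (hd : R.natDegree ≤ N + 1) :
    R.coeff 0 = (R.coeff N - R.coeff (N + 1) * waveSub p e (-m)) * (wave p e m).coeff 0 := by
  have := congrArg (fun S => S.coeff 0) (hR.eq_combination h h' hd)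
  simpa using this

/-! ### Lattice shifts and the quadratic relation on a square -/

/-- The data `(e', m')` arise from `(e, m)` by the lattice shift with parameter `c`. -/
def IsShift (c : ℝ) (p e m e' m' : Fin N → ℂ) : Prop :=
  ∀ i, e' i * (1 - c * p i) = e i ∧ m' i * (1 + c * p i) = m i ∧
    1 - (c : ℂ) * p i ≠ 0 ∧ 1 + (c : ℂ) * p i ≠ 0

/-- The ratio of the two alternants; on real data it is the inverse square of the phase of
the alternant, up to sign. -/
noncomputable def altRatio (p e m : Fin N → ℂ) : ℂ := altDet p e (-m) / altDet p e m

/-- Both alternants are nonzero. -/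
def AltNonzero (p e m : Fin N → ℂ) : Prop := altDet p e m ≠ 0 ∧ altDet p e (-m) ≠ 0

theorem AltNonzero.neg (h : AltNonzero p e m) : AltNonzero p e (-m) :=
  ⟨h.2, by rw [neg_neg]; exact h.1⟩

theorem AltNonzero.ratio_ne_zero (h : AltNonzero p e m) : altRatio p e m ≠ 0 :=
  div_ne_zero h.2 h.1

theorem altRatio_neg : altRatio p e (-m) = (altRatio p e m)⁻¹ := by
  simp [altRatio]

variable {e' m' : Fin N → ℂ}

theorem IsShift.neg {c : ℝ} (h : IsShift c p e m e' m') : IsShift c p e (-m) e' (-m') :=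
  fun i => ⟨(h i).1, by simp [← (h i).2.1], (h i).2.2⟩

/-- The relation between subleading coefficients under a lattice shift. -/
theorem IsShift.waveSub_relation {c : ℝ} (hp : ∀ i, p i ≠ 0) (hs : IsShift c p e m e' m')
    (h : AltNonzero p e m) (h' : AltNonzero p e' m') :
    c * (waveSub p e m - waveSub p e' (-m')) = 1 - altRatio p e m / altRatio p e' m' := by
  -- The factor 1 - cX takes the values 1 - c p_i and 1 + c p_i at p_i and -p_i, exactly the factors
  -- that turn the shifted data back into the old ones.
  have hR : InKer p e' m' ((1 - C (c : ℂ) * X) * wave p e m) := fun i => by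
    have := inKer_wave (p := p) (e := e) (m := m) i
    simp only [eval_mul, eval_sub, eval_one, eval_C, eval_X]
    rw [← (hs i).1, ← (hs i).2.1] at this
    linear_combination this
  have hd : ((1 - C (c : ℂ) * X) * wave p e m).natDegree ≤ N + 1 := by
    rw [add_comm]
    refine natDegree_mul_le_of_le ?_ natDegree_wave_le
    refine (natDegree_sub_le _ _).trans (max_le (by simp) (natDegree_C_mul_le _ _ |>.trans natDegree_X_le))
  have h0 := hR.coeff_zero_eq h'.1 h'.2 hd
  have e1 : ((1 - C (c : ℂ) * X) * wave p e m).coeff (N + 1) = -(c : ℂ) := by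
    rw [sub_mul, one_mul, mul_assoc, coeff_sub, coeff_C_mul, coeff_X_mul, coeff_wave_self h.1,
      coeff_eq_zero_of_natDegree_lt (natDegree_wave_le.trans_lt N.lt_succ_self)]
    ring
  have e2 : ((1 - C (c : ℂ) * X) * wave p e m).coeff N = 1 - c * waveSub p e m := by
    rw [sub_mul, one_mul, mul_assoc, coeff_sub, coeff_C_mul, coeff_wave_self h.1,
      waveSub]
  have e3 : ((1 - C (c : ℂ) * X) * wave p e m).coeff 0 = (wave p e m).coeff 0 := by
    rw [sub_mul, one_mul, mul_assoc, coeff_sub, coeff_C_mul]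
    simp
  have hprod : (∏ i, p i) ≠ 0 := Finset.prod_ne_zero_iff.2 fun i _ => hp i
  rw [e1, e2, e3, coeff_wave_zero, coeff_wave_zero, mul_left_comm] at h0
  have h1 := mul_left_cancel₀ (mul_ne_zero (pow_ne_zero N (by norm_num)) hprod) h0
  have h2 := h'.ratio_ne_zero
  unfold altRatio at h2 ⊢
  rw [h1, mul_div_assoc, div_self h2]
  ring

/-- The discrete potential mKdV equation in terms of ratios of alternants. -/
theorem altRatio_square {a b : ℝ} (hp : ∀ i, p i ≠ 0) {e₀₀ m₀₀ e₁₀ m₁₀ e₀₁ m₀₁ e₁₁ m₁₁ : Fin N → ℂ}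
    (ha₀ : IsShift a p e₀₀ m₀₀ e₁₀ m₁₀) (ha₁ : IsShift a p e₀₁ m₀₁ e₁₁ m₁₁)
    (hb₀ : IsShift b p e₀₀ m₀₀ e₀₁ m₀₁) (hb₁ : IsShift b p e₁₀ m₁₀ e₁₁ m₁₁)
    (h₀₀ : AltNonzero p e₀₀ m₀₀) (h₁₀ : AltNonzero p e₁₀ m₁₀)
    (h₀₁ : AltNonzero p e₀₁ m₀₁) (h₁₁ : AltNonzero p e₁₁ m₁₁) :
    b * (altRatio p e₀₀ m₀₀ * altRatio p e₀₁ m₀₁ - altRatio p e₁₁ m₁₁ * altRatio p e₁₀ m₁₀) =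
      a * (altRatio p e₀₀ m₀₀ * altRatio p e₁₀ m₁₀ - altRatio p e₁₁ m₁₁ * altRatio p e₀₁ m₀₁) := by
  -- Both paths from corner 00 to corner 11 express a b (w₀₀ - w₁₁). The second leg uses the data
  -- with -m, so that w⁻ at the intermediate corner cancels.
  have k1 := ha₀.waveSub_relation hp h₀₀ h₁₀
  have k2 := hb₁.neg.waveSub_relation hp h₁₀.neg h₁₁.neg
  have k3 := hb₀.waveSub_relation hp h₀₀ h₀₁
  have k4 := ha₁.neg.waveSub_relation hp h₀₁.neg h₁₁.neg
  rw [neg_neg, altRatio_neg, altRatio_neg] at k2 k4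
  have n00 := h₀₀.ratio_ne_zero
  have n10 := h₁₀.ratio_ne_zero
  have n01 := h₀₁.ratio_ne_zero
  have n11 := h₁₁.ratio_ne_zero
  generalize altRatio p e₀₀ m₀₀ = r00 at *
  generalize altRatio p e₁₀ m₁₀ = r10 at *
  generalize altRatio p e₀₁ m₀₁ = r01 at *
  generalize altRatio p e₁₁ m₁₁ = r11 at *
  have key : (b : ℂ) * (1 - r00 / r10) + a * (1 - r10⁻¹ / r11⁻¹) =
      a * (1 - r00 / r01) + b * (1 - r01⁻¹ / r11⁻¹) := by
    linear_combination -b * k1 - a * k2 + a * k3 + b * k4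
  field_simp at key
  linear_combination -key

theorem altRatio_mul_row {κ : Fin N → ℂ} (hκ : ∀ i, κ i ≠ 0) :
    altRatio p (fun i => κ i * e i) (fun i => κ i * m i) = altRatio p e m := by
  have h : (-fun i => κ i * m i) = fun i => κ i * (-m) i := by
    funext i; simp
  have hprod : (∏ i, κ i) ≠ 0 := Finset.prod_ne_zero_iff.2 fun i _ => hκ i
  rw [altRatio, h, altDet_mul_row, altDet_mul_row, mul_div_mul_left _ _ hprod, altRatio]

theorem AltNonzero.mul_row {κ : Fin N → ℂ} (hκ : ∀ i, κ i ≠ 0) (hn : AltNonzero p e m) :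
    AltNonzero p (fun i => κ i * e i) (fun i => κ i * m i) := by
  have h : (-fun i => κ i * m i) = fun i => κ i * (-m) i := by
    funext i; simp
  have hprod : (∏ i, κ i) ≠ 0 := Finset.prod_ne_zero_iff.2 fun i _ => hκ i
  rw [AltNonzero, h, altDet_mul_row, altDet_mul_row]
  exact ⟨mul_ne_zero hprod hn.1, mul_ne_zero hprod hn.2⟩

/-- Opposite shifts cancel in the ratio. -/
theorem altRatio_shift_shift_neg {a : ℝ} {e'' m'' : Fin N → ℂ} (h : IsShift a p e m e' m')
    (h' : IsShift (-a) p e' m' e'' m'') : altRatio p e'' m'' = altRatio p e m := by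
  -- The two shifts together multiply e_i and m_i by the same factor 1 / (1 - a² p_i²), which drops
  -- out of the ratio.
  have hκ : ∀ i, ((1 - a * p i) * (1 + a * p i) : ℂ) ≠ 0 := fun i =>
    mul_ne_zero (h i).2.2.1 (h i).2.2.2
  rw [← altRatio_mul_row hκ]
  congr 1 <;> funext i <;> have h1 := h i <;> have h2 := h' i <;>
    simp only [Complex.ofReal_neg] at h2
  · rw [← h1.1, ← h2.1]; ring
  · rw [← h1.2.1, ← h2.2.1]; ring

end Algebra

/-! ### Appending one row -/

section Append

variable {N : ℕ} {p e m : Fin (N + 1) → ℂ}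

/-- The relation between subleading coefficients when one more row is appended. -/
theorem waveSub_append (hp : ∀ i, p i ≠ 0)
    (h : AltNonzero (fun i : Fin N => p i.castSucc) (fun i => e i.castSucc) (fun i => m i.castSucc))
    (h' : AltNonzero p e m) :
    waveSub p e m =
      waveSub (fun i : Fin N => p i.castSucc) (fun i => e i.castSucc) (-fun i => m i.castSucc) -
        p (Fin.last N) * (altRatio p e m /
          altRatio (fun i : Fin N => p i.castSucc) (fun i => e i.castSucc)
            (fun i => m i.castSucc)) := by
  -- Forgetting the last condition puts the wave polynomial of N + 1 rows, of degree N + 1, in the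
  -- kernel for the first N rows.
  have hR : InKer (fun i : Fin N => p i.castSucc) (fun i => e i.castSucc)
      (fun i => m i.castSucc) (wave p e m) := fun i => inKer_wave i.castSucc
  have h0 := hR.coeff_zero_eq h.1 h.2 natDegree_wave_le
  rw [coeff_wave_self h'.1, coeff_wave_zero, coeff_wave_zero, Fin.prod_univ_castSucc] at h0
  have hprod : (∏ i : Fin N, p i.castSucc) ≠ 0 := Finset.prod_ne_zero_iff.2 fun i _ => hp _
  have h2 := h.ratio_ne_zero
  have e2 : (wave p e m).coeff N = waveSub p e m := by rw [waveSub, coeff_X_mul]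
  rw [e2] at h0
  change _ * altRatio p e m = _ * (_ * altRatio _ _ _) at h0
  have hpow : ((-1 : ℂ)) ^ N ≠ 0 := pow_ne_zero N (by norm_num)
  have h1 : -(p (Fin.last N)) * altRatio p e m =
      (waveSub p e m - 1 * waveSub (fun i : Fin N => p i.castSucc) (fun i => e i.castSucc)
        (-fun i => m i.castSucc)) * altRatio (fun i : Fin N => p i.castSucc)
          (fun i => e i.castSucc) (fun i => m i.castSucc) := by
    refine mul_left_cancel₀ (mul_ne_zero hpow hprod) ?_
    rw [pow_succ] at h0
    linear_combination h0
  field_simp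
  linear_combination -h1

theorem AltNonzero.castSucc_neg
    (h : AltNonzero (fun i : Fin N => p i.castSucc) (fun i => e i.castSucc)
      (fun i => m i.castSucc)) :
    AltNonzero (fun i : Fin N => p i.castSucc) (fun i => e i.castSucc)
      (fun i => (-m) i.castSucc) :=
  h.neg

/-- The companion of `waveSub_append` for the data `(e, -m)`. -/
theorem waveSub_append_neg (hp : ∀ i, p i ≠ 0)
    (h : AltNonzero (fun i : Fin N => p i.castSucc) (fun i => e i.castSucc) (fun i => m i.castSucc))
    (h' : AltNonzero p e m) :
    waveSub p e (-m) =
      waveSub (fun i : Fin N => p i.castSucc) (fun i => e i.castSucc) (fun i => m i.castSucc) -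
        p (Fin.last N) * (altRatio (fun i : Fin N => p i.castSucc) (fun i => e i.castSucc)
            (fun i => m i.castSucc) / altRatio p e m) := by
  have := waveSub_append hp h.castSucc_neg h'.neg
  have e1 : (-fun i : Fin N => (-m) i.castSucc) = fun i => m i.castSucc := by
    funext i; simp
  have e2 : (fun i : Fin N => (-m) i.castSucc) = -fun i : Fin N => m i.castSucc := rfl
  rw [e1, e2, altRatio_neg, altRatio_neg, inv_div_inv] at this
  exact this

/-- Appending a row and shifting: the discrete Bäcklund relation in terms of ratios. -/
theorem altRatio_append_square {a : ℝ} {e' m' : Fin (N + 1) → ℂ} (hp : ∀ i, p i ≠ 0)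
    (hs : IsShift a p e m e' m')
    (h₀ : AltNonzero (fun i : Fin N => p i.castSucc) (fun i => e i.castSucc)
      (fun i => m i.castSucc))
    (h₁ : AltNonzero (fun i : Fin N => p i.castSucc) (fun i => e' i.castSucc)
      (fun i => m' i.castSucc))
    (h₀' : AltNonzero p e m) (h₁' : AltNonzero p e' m') :
    altRatio (fun i : Fin N => p i.castSucc) (fun i => e i.castSucc) (fun i => m i.castSucc) *
        altRatio p e m -
      altRatio p e' m' *
        altRatio (fun i : Fin N => p i.castSucc) (fun i => e' i.castSucc)
          (fun i => m' i.castSucc) =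
      -(a * p (Fin.last N)) *
        (altRatio (fun i : Fin N => p i.castSucc) (fun i => e i.castSucc)
            (fun i => m i.castSucc) *
          altRatio (fun i : Fin N => p i.castSucc) (fun i => e' i.castSucc)
            (fun i => m' i.castSucc) -
        altRatio p e' m' * altRatio p e m) := by
  have hs' : IsShift a (fun i : Fin N => p i.castSucc) (fun i => e i.castSucc)
      (fun i => m i.castSucc) (fun i => e' i.castSucc) (fun i => m' i.castSucc) := fun i => hs _
  -- Expressing w of the N + 1 rows through the first N turns its shift relation into one with the
  -- same difference of subleading coefficients as the negated relation for N rows.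
  have k1 := hs'.neg.waveSub_relation (fun i => hp _) h₀.neg h₁.neg
  have k2 := hs.waveSub_relation hp h₀' h₁'
  rw [waveSub_append hp h₀ h₀', waveSub_append_neg hp h₁ h₁'] at k2
  rw [neg_neg, altRatio_neg, altRatio_neg] at k1
  have n0 := h₀.ratio_ne_zero
  have n1 := h₁.ratio_ne_zero
  have n0' := h₀'.ratio_ne_zero
  have n1' := h₁'.ratio_ne_zero
  generalize altRatio (fun i : Fin N => p i.castSucc) (fun i => e i.castSucc)
      (fun i => m i.castSucc) = s0 at *
  generalize altRatio (fun i : Fin N => p i.castSucc) (fun i => e' i.castSucc)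
      (fun i => m' i.castSucc) = s1 at *
  generalize altRatio p e m = t0 at *
  generalize altRatio p e' m' = t1 at *
  have key : (1 - s0⁻¹ / s1⁻¹ : ℂ) - a * p (Fin.last N) * (t0 / s0 - s1 / t1) = 1 - t0 / t1 := by
    linear_combination k2 - k1
  field_simp at key
  linear_combination key

end Append

/-! ### Plane waves and derivatives of polynomial-valued paths -/

/-- The exponentials `A_i exp (q_i x - 4 q_i³ t)`. -/
noncomputable def planeWave {N : ℕ} (A q : Fin N → ℂ) (x t : ℝ) (i : Fin N) : ℂ :=
  A i * Complex.exp (q i * x - 4 * q i ^ 3 * t)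

/-- The polynomial whose coefficients are the derivatives of the coefficients of `Q`. -/
noncomputable def coeffDeriv (N : ℕ) (Q : ℝ → ℂ[X]) (x : ℝ) : ℂ[X] :=
  ∑ j ∈ Finset.range N, C (deriv (fun x => (Q x).coeff j) x) * X ^ j

theorem coeff_coeffDeriv_of_le {N : ℕ} {Q : ℝ → ℂ[X]} {x : ℝ} (n : ℕ) (hn : N ≤ n) :
    (coeffDeriv N Q x).coeff n = 0 := by
  simp only [coeffDeriv, finsetSum_coeff, coeff_C_mul, coeff_X_pow]
  refine Finset.sum_eq_zero fun j hj => ?_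
  rw [Finset.mem_range] at hj
  simp [show n ≠ j by omega]

section PolynomialPath

variable {N : ℕ} {Q : ℝ → ℂ[X]} {x : ℝ}

/-- The leading coefficient is 1 near x and hence stationary, so the derivative polynomial has
degree below N. A local hypothesis is all there is, because the wave polynomial is monic only where
the alternant does not vanish. -/
theorem hasDerivAt_coeff (hlead : ∀ᶠ y in nhds x, (Q y).coeff N = 1)
    (hdeg : ∀ y, (Q y).natDegree ≤ N)
    (hdiff : ∀ n, DifferentiableAt ℝ (fun x => (Q x).coeff n) x) (n : ℕ) :
    HasDerivAt (fun x => (Q x).coeff n) ((coeffDeriv N Q x).coeff n) x := by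
  rcases lt_trichotomy n N with h | rfl | h
  · have : (coeffDeriv N Q x).coeff n = deriv (fun x => (Q x).coeff n) x := by
      simp only [coeffDeriv, finsetSum_coeff, coeff_C_mul, coeff_X_pow, mul_ite, mul_one, mul_zero]
      rw [Finset.sum_ite_eq, if_pos (Finset.mem_range.2 h)]
    rw [this]
    exact (hdiff n).hasDerivAt
  · rw [coeff_coeffDeriv_of_le _ le_rfl]
    exact (hasDerivAt_const x (1 : ℂ)).congr_of_eventuallyEq hlead
  · rw [coeff_coeffDeriv_of_le _ h.le]
    have : (fun x => (Q x).coeff n) = fun _ => 0 := by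
      funext y
      exact coeff_eq_zero_of_natDegree_lt ((hdeg y).trans_lt h)
    rw [this]
    exact hasDerivAt_const x (0 : ℂ)

theorem hasDerivAt_coeff_X_pow_mul (hlead : ∀ᶠ y in nhds x, (Q y).coeff N = 1)
    (hdeg : ∀ y, (Q y).natDegree ≤ N)
    (hdiff : ∀ n, DifferentiableAt ℝ (fun x => (Q x).coeff n) x) (k n : ℕ) :
    HasDerivAt (fun x => (X ^ k * Q x).coeff n) ((X ^ k * coeffDeriv N Q x).coeff n) x := by
  simp only [coeff_X_pow_mul']
  split_ifs
  · exact hasDerivAt_coeff hlead hdeg hdiff _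
  · exact hasDerivAt_const x (0 : ℂ)

theorem hasDerivAt_eval (hlead : ∀ᶠ y in nhds x, (Q y).coeff N = 1)
    (hdeg : ∀ y, (Q y).natDegree ≤ N)
    (hdiff : ∀ n, DifferentiableAt ℝ (fun x => (Q x).coeff n) x) (z : ℂ) :
    HasDerivAt (fun x => (Q x).eval z) ((coeffDeriv N Q x).eval z) x := by
  have h1 : (fun x => (Q x).eval z) = fun x => ∑ n ∈ Finset.range (N + 1), (Q x).coeff n * z ^ n := by
    funext y
    exact eval_eq_sum_range' (Nat.lt_succ_of_le (hdeg y)) z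
  have h2 : (coeffDeriv N Q x).natDegree < N + 1 :=
    Nat.lt_succ_of_le (natDegree_le_iff_coeff_eq_zero.2 fun n hn =>
      coeff_coeffDeriv_of_le n hn.le)
  rw [h1, eval_eq_sum_range' h2]
  exact HasDerivAt.fun_sum fun n _ => (hasDerivAt_coeff hlead hdeg hdiff n).mul_const _

/-- Differentiating the kernel condition along a flow `e_i' = K(p_i) e_i`, `m_i' = K(-p_i) m_i`
with a polynomial `K`. -/
theorem inKer_coeffDeriv (hlead : ∀ᶠ y in nhds x, (Q y).coeff N = 1)
    (hdeg : ∀ y, (Q y).natDegree ≤ N)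
    (hdiff : ∀ n, DifferentiableAt ℝ (fun x => (Q x).coeff n) x)
    {p : Fin N → ℂ} {e m : ℝ → Fin N → ℂ} {K : ℂ[X]}
    (he : ∀ i, HasDerivAt (fun x => e x i) (K.eval (p i) * e x i) x)
    (hm : ∀ i, HasDerivAt (fun x => m x i) (K.eval (-p i) * m x i) x)
    (hQ : ∀ y, InKer p (e y) (m y) (Q y)) :
    InKer p (e x) (m x) (coeffDeriv N Q x + K * Q x) := by
  intro i
  have h := ((he i).mul (hasDerivAt_eval hlead hdeg hdiff (p i))).add
    ((hm i).mul (hasDerivAt_eval hlead hdeg hdiff (-p i)))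
  have h0 : ((fun x => e x i) * fun x => (Q x).eval (p i)) +
      ((fun x => m x i) * fun x => (Q x).eval (-p i)) = fun _ => (0 : ℂ) := by
    funext y
    exact hQ y i
  rw [h0] at h
  have := h.unique (hasDerivAt_const x 0)
  simp only [eval_add, eval_mul]
  linear_combination this

end PolynomialPath

/-! ### Evolution of the wave polynomial in x and t -/

section Flow

variable {N : ℕ} {p A B : Fin N → ℂ}

theorem planeWave_neg (A q : Fin N → ℂ) (x t : ℝ) :
    planeWave (-A) q x t = -planeWave A q x t := by
  funext i; simp [planeWave]

theorem hasDerivAt_planeWave_x (A q : Fin N → ℂ) (x t : ℝ) (i : Fin N) :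
    HasDerivAt (fun x => planeWave A q x t i) (q i * planeWave A q x t i) x := by
  have h : HasDerivAt (fun x : ℝ => q i * (x : ℂ) - 4 * q i ^ 3 * t) (q i) x := by
    simpa using ((Complex.ofRealCLM.hasDerivAt (x := x)).const_mul (q i)).sub_const
      (4 * q i ^ 3 * (t : ℂ))
  refine (h.cexp.const_mul (A i)).congr_deriv ?_
  unfold planeWave
  ring

theorem hasDerivAt_planeWave_t (A q : Fin N → ℂ) (x t : ℝ) (i : Fin N) :
    HasDerivAt (fun t => planeWave A q x t i) (-4 * q i ^ 3 * planeWave A q x t i) t := by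
  have h : HasDerivAt (fun t : ℝ => q i * (x : ℂ) - 4 * q i ^ 3 * t) (-4 * q i ^ 3) t := by
    simpa using ((Complex.ofRealCLM.hasDerivAt (x := t)).const_mul (4 * q i ^ 3)).const_sub
      (q i * (x : ℂ))
  refine (h.cexp.const_mul (A i)).congr_deriv ?_
  unfold planeWave
  ring

theorem contDiff_planeWave (A q : Fin N → ℂ) (i : Fin N) {n : WithTop ℕ∞} :
    ContDiff ℝ n fun z : ℝ × ℝ => planeWave A q z.1 z.2 i := by
  unfold planeWave
  have h1 : ContDiff ℝ n fun z : ℝ × ℝ => ((z.1 : ℝ) : ℂ) :=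
    Complex.ofRealCLM.contDiff.comp contDiff_fst
  have h2 : ContDiff ℝ n fun z : ℝ × ℝ => ((z.2 : ℝ) : ℂ) :=
    Complex.ofRealCLM.contDiff.comp contDiff_snd
  exact contDiff_const.mul ((contDiff_const.mul h1).sub (contDiff_const.mul h2)).cexp

theorem contDiff_det {E : Type*} [NormedAddCommGroup E] [NormedSpace ℝ E] {n : WithTop ℕ∞}
    {M : E → Matrix (Fin N) (Fin N) ℂ} (h : ∀ i j, ContDiff ℝ n fun z => M z i j) :
    ContDiff ℝ n fun z => (M z).det := by
  simp only [Matrix.det_apply]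
  exact ContDiff.sum fun σ _ => (contDiff_prod fun i _ => h _ _).const_smul _

theorem contDiff_altEntry (s : ℕ) (i : Fin N) {n : WithTop ℕ∞} :
    ContDiff ℝ n fun z : ℝ × ℝ =>
      altEntry p (planeWave A p z.1 z.2) (planeWave B (-p) z.1 z.2) s i :=
  ((contDiff_planeWave A p i).mul contDiff_const).add
    ((contDiff_planeWave B (-p) i).mul contDiff_const)

theorem contDiff_altMinor (j : Fin (N + 1)) {n : WithTop ℕ∞} :
    ContDiff ℝ n fun z : ℝ × ℝ =>
      altMinor p (planeWave A p z.1 z.2) (planeWave B (-p) z.1 z.2) j :=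
  contDiff_det fun _ _ => contDiff_altEntry _ _

theorem contDiff_altDet {n : WithTop ℕ∞} :
    ContDiff ℝ n fun z : ℝ × ℝ =>
      altDet p (planeWave A p z.1 z.2) (planeWave B (-p) z.1 z.2) :=
  contDiff_det fun _ _ => contDiff_altEntry _ _

/-- The wave polynomial along the continuous flows. -/
noncomputable def flowWave (p A B : Fin N → ℂ) (x t : ℝ) : ℂ[X] :=
  wave p (planeWave A p x t) (planeWave B (-p) x t)

/-- Nonvanishing of the two alternants along the continuous flows. -/
def FlowNonzero (p A B : Fin N → ℂ) (x t : ℝ) : Prop :=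
  AltNonzero p (planeWave A p x t) (planeWave B (-p) x t)

theorem FlowNonzero.neg {x t : ℝ} (h : FlowNonzero p A B x t) : FlowNonzero p A (-B) x t := by
  unfold FlowNonzero
  rw [planeWave_neg]
  exact AltNonzero.neg h

theorem FlowNonzero.eventually {x t : ℝ} (h : FlowNonzero p A B x t) :
    ∀ᶠ z in nhds (x, t), FlowNonzero p A B z.1 z.2 := by
  have h1 := (contDiff_altDet (p := p) (A := A) (B := B) (n := 0)).continuous.continuousAt
    (x := (x, t))
  have h2 := (contDiff_altDet (p := p) (A := A) (B := -B) (n := 0)).continuous.continuousAt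
    (x := (x, t))
  simp only [planeWave_neg] at h2
  filter_upwards [h1.eventually_ne h.1, h2.eventually_ne h.2] with z hz1 hz2 using ⟨hz1, hz2⟩

theorem FlowNonzero.eventually_x {x t : ℝ} (h : FlowNonzero p A B x t) :
    ∀ᶠ y in nhds x, FlowNonzero p A B y t :=
  (Continuous.prodMk continuous_id continuous_const).continuousAt.eventually
    (f := fun y : ℝ => (y, t)) h.eventually

theorem FlowNonzero.eventually_t {x t : ℝ} (h : FlowNonzero p A B x t) :
    ∀ᶠ y in nhds t, FlowNonzero p A B x y :=
  (Continuous.prodMk continuous_const continuous_id).continuousAt.eventually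
    (f := fun y : ℝ => (x, y)) h.eventually

theorem FlowNonzero.differentiableAt_coeff {x t : ℝ} (h : FlowNonzero p A B x t) (n : ℕ) :
    DifferentiableAt ℝ (fun z : ℝ × ℝ => (flowWave p A B z.1 z.2).coeff n) (x, t) := by
  simp only [flowWave, coeff_wave]
  split_ifs
  · refine DifferentiableAt.mul (DifferentiableAt.inv ?_ h.1) (DifferentiableAt.const_mul ?_ _)
    · exact contDiff_altDet.differentiable one_ne_zero _
    · exact (contDiff_altMinor _).differentiable one_ne_zero _
  · exact differentiableAt_const _

/-- The coefficients of the wave polynomial, counted from the top. -/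
noncomputable def topCoeff (p A B : Fin N → ℂ) (k : ℕ) (x t : ℝ) : ℂ :=
  (X ^ k * flowWave p A B x t).coeff N

theorem topCoeff_one (x t : ℝ) :
    topCoeff p A B 1 x t = waveSub p (planeWave A p x t) (planeWave B (-p) x t) := by
  simp [topCoeff, flowWave, waveSub]

theorem flowWave_neg (x t : ℝ) :
    flowWave p A (-B) x t = wave p (planeWave A p x t) (-planeWave B (-p) x t) := by
  rw [flowWave, planeWave_neg]

/-- The evolution of the wave polynomial in `x`. -/
theorem FlowNonzero.coeffDeriv_x {x t : ℝ} (h : FlowNonzero p A B x t) :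
    coeffDeriv N (fun x => flowWave p A B x t) x + X * flowWave p A B x t =
        X * flowWave p A (-B) x t +
          C (topCoeff p A B 1 x t - topCoeff p A (-B) 1 x t) * flowWave p A B x t ∧
      ∀ k n, HasDerivAt (fun x => (X ^ k * flowWave p A B x t).coeff n)
        ((X ^ k * coeffDeriv N (fun x => flowWave p A B x t) x).coeff n) x := by
  have hlead : ∀ᶠ y in nhds x, (flowWave p A B y t).coeff N = 1 :=
    h.eventually_x.mono fun y hy => coeff_wave_self hy.1
  have hdeg : ∀ y, (flowWave p A B y t).natDegree ≤ N := fun y => natDegree_wave_le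
  have hdiff : ∀ n, DifferentiableAt ℝ (fun x => (flowWave p A B x t).coeff n) x := fun n =>
    (h.differentiableAt_coeff n).comp x (f := fun y : ℝ => (y, t)) (by fun_prop)
  refine ⟨?_, fun k n => hasDerivAt_coeff_X_pow_mul hlead hdeg hdiff k n⟩
  have hker := inKer_coeffDeriv (Q := fun x => flowWave p A B x t) hlead hdeg hdiff (p := p)
    (e := fun x => planeWave A p x t)
    (m := fun x => planeWave B (-p) x t) (K := X)
    (fun i => by simpa using hasDerivAt_planeWave_x A p x t i)
    (fun i => by simpa using hasDerivAt_planeWave_x B (-p) x t i) (fun y => inKer_wave)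
  -- Q_x has degree below N, so the two top coefficients come from X Q alone.
  have c1 : (coeffDeriv N (fun x => flowWave p A B x t) x + X * flowWave p A B x t).coeff (N + 1)
      = 1 := by
    rw [coeff_add, coeff_coeffDeriv_of_le _ N.le_succ, coeff_X_mul, zero_add]
    exact coeff_wave_self h.1
  have c2 : (coeffDeriv N (fun x => flowWave p A B x t) x + X * flowWave p A B x t).coeff N
      = topCoeff p A B 1 x t := by
    rw [coeff_add, coeff_coeffDeriv_of_le _ le_rfl, zero_add, topCoeff, pow_one]
  have := hker.eq_combination h.1 h.2 (natDegree_le_iff_coeff_eq_zero.2 fun n hn => by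
    obtain ⟨k, rfl⟩ : ∃ k, n = k + 1 := ⟨n - 1, by omega⟩
    rw [coeff_add, coeff_coeffDeriv_of_le _ (by omega), coeff_X_mul, zero_add]
    exact coeff_eq_zero_of_natDegree_lt (lt_of_le_of_lt (hdeg x) (by omega)))
  rw [c1, c2] at this
  rw [this, topCoeff_one (B := -B), planeWave_neg, flowWave_neg, C_1, one_mul, one_mul]
  rfl

/-- Multiply the x-evolution by X^k and read off the coefficient of X^N. Counting by X^k instead of
the index N - k makes coefficients below the constant term zero, so the recursion also holds for
small N. -/
theorem FlowNonzero.hasDerivAt_topCoeff {x t : ℝ} (h : FlowNonzero p A B x t) (k : ℕ) :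
    HasDerivAt (fun x => topCoeff p A B k x t)
      (topCoeff p A (-B) (k + 1) x t - topCoeff p A B (k + 1) x t +
        (topCoeff p A B 1 x t - topCoeff p A (-B) 1 x t) * topCoeff p A B k x t) x := by
  obtain ⟨h1, h2⟩ := h.coeffDeriv_x
  have h3 := congrArg (fun R => (X ^ k * R).coeff N) h1
  simp only [mul_add, coeff_add, ← mul_assoc, ← pow_succ] at h3
  rw [mul_comm (X ^ k) (C _), mul_assoc, coeff_C_mul] at h3
  refine (h2 k N).congr_deriv ?_
  unfold topCoeff
  unfold topCoeff at h3
  linear_combination h3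

/-- Terms with a factor X disappear at 0, so the logarithmic derivative of the constant term is w -
w⁻. -/
theorem FlowNonzero.hasDerivAt_coeff_zero {x t : ℝ} (h : FlowNonzero p A B x t) :
    HasDerivAt (fun x => (flowWave p A B x t).coeff 0)
      ((topCoeff p A B 1 x t - topCoeff p A (-B) 1 x t) * (flowWave p A B x t).coeff 0) x := by
  obtain ⟨h1, h2⟩ := h.coeffDeriv_x
  have h3 := congrArg (fun R => R.coeff 0) h1
  simp only [coeff_add, coeff_C_mul, coeff_X_mul_zero, zero_add, add_zero] at h3
  have := h2 0 0
  simp only [pow_zero, one_mul] at this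
  rwa [h3] at this

/-- The evolution of the constant coefficient of the wave polynomial in `t`. -/
theorem FlowNonzero.hasDerivAt_coeff_zero_t {x t : ℝ} (h : FlowNonzero p A B x t) :
    HasDerivAt (fun t => (flowWave p A B x t).coeff 0)
      ((4 * (X ^ 2 * coeffDeriv N (fun x => flowWave p A B x t) x).coeff N -
        4 * (X * coeffDeriv N (fun x => flowWave p A B x t) x).coeff N * topCoeff p A (-B) 1 x t)
        * (flowWave p A B x t).coeff 0) t := by
  have hlead : ∀ᶠ y in nhds t, (flowWave p A B x y).coeff N = 1 :=
    h.eventually_t.mono fun y hy => coeff_wave_self hy.1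
  have hdeg : ∀ y, (flowWave p A B x y).natDegree ≤ N := fun y => natDegree_wave_le
  have hdiff : ∀ n, DifferentiableAt ℝ (fun t => (flowWave p A B x t).coeff n) t := fun n =>
    (h.differentiableAt_coeff n).comp t (f := fun y : ℝ => (x, y)) (by fun_prop)
  have hker := inKer_coeffDeriv (Q := fun t => flowWave p A B x t) hlead hdeg hdiff (p := p)
    (e := fun t => planeWave A p x t)
    (m := fun t => planeWave B (-p) x t) (K := C (-4) * X ^ 3)
    (fun i => by simpa using hasDerivAt_planeWave_t A p x t i)
    (fun i => by simpa using hasDerivAt_planeWave_t B (-p) x t i) (fun y => inKer_wave)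
  have hx := h.coeffDeriv_x.1
  have hkerx : InKer p (planeWave A p x t) (planeWave B (-p) x t)
      (coeffDeriv N (fun x => flowWave p A B x t) x + X * flowWave p A B x t) := by
    rw [hx, flowWave_neg]
    exact inKer_wave.X_mul.add (inKer_wave.C_mul _)
  -- Adding 4X²(Q_x + X Q) to Q_t - 4X³ Q cancels the cubic term; what remains, Q_t + 4X² Q_x, has
  -- degree at most N + 1 and constant term that of Q_t.
  have hsum := hker.add (hkerx.X_sq_mul.C_mul 4)
  set Qt := coeffDeriv N (fun t => flowWave p A B x t) t with hQt
  set Qx := coeffDeriv N (fun x => flowWave p A B x t) x with hQx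
  have hR : Qt + C (-4) * X ^ 3 * flowWave p A B x t +
      C 4 * (X ^ 2 * (Qx + X * flowWave p A B x t)) = Qt + C 4 * (X ^ 2 * Qx) := by
    rw [C_neg]
    ring
  rw [hR] at hsum
  have c1 : (Qt + C 4 * (X ^ 2 * Qx)).coeff (N + 1) = 4 * (X * Qx).coeff N := by
    rw [coeff_add, coeff_C_mul, hQt, coeff_coeffDeriv_of_le _ N.le_succ, pow_two, mul_assoc,
      coeff_X_mul, zero_add]
  have c2 : (Qt + C 4 * (X ^ 2 * Qx)).coeff N = 4 * (X ^ 2 * Qx).coeff N := by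
    rw [coeff_add, coeff_C_mul, hQt, coeff_coeffDeriv_of_le _ le_rfl, zero_add]
  have c0 : (Qt + C 4 * (X ^ 2 * Qx)).coeff 0 = Qt.coeff 0 := by
    rw [coeff_add, coeff_C_mul, pow_two, mul_assoc, coeff_X_mul_zero, mul_zero, add_zero]
  have := hsum.coeff_zero_eq h.1 h.2 (natDegree_le_iff_coeff_eq_zero.2 fun n hn => by
    obtain ⟨k, rfl⟩ : ∃ k, n = k + 2 := ⟨n - 2, by omega⟩
    rw [coeff_add, coeff_C_mul, hQt, coeff_coeffDeriv_of_le _ (by omega), coeff_X_pow_mul, hQx,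
      coeff_coeffDeriv_of_le _ (by omega)]
    ring)
  rw [c0, c1, c2, ← planeWave_neg, ← topCoeff_one] at this
  rw [← flowWave] at this
  rw [← this]
  exact hasDerivAt_coeff hlead hdeg hdiff 0

/-- The logarithmic derivative in `x` of the ratio of alternants. -/
noncomputable def logSlope (p A B : Fin N → ℂ) (x t : ℝ) : ℂ :=
  topCoeff p A B 1 x t - topCoeff p A (-B) 1 x t

/-- The ratio of alternants along the flow. -/
noncomputable def flowRatio (p A B : Fin N → ℂ) (x t : ℝ) : ℂ :=
  altRatio p (planeWave A p x t) (planeWave B (-p) x t)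

/-- The derivative of `logSlope`. -/
noncomputable def logSlope' (p A B : Fin N → ℂ) (x t : ℝ) : ℂ :=
  2 * (topCoeff p A (-B) 2 x t - topCoeff p A B 2 x t) +
    logSlope p A B x t * (topCoeff p A B 1 x t + topCoeff p A (-B) 1 x t)

/-- The second derivative of `logSlope`. -/
noncomputable def logSlope'' (p A B : Fin N → ℂ) (x t : ℝ) : ℂ :=
  2 * (2 * (topCoeff p A B 3 x t - topCoeff p A (-B) 3 x t) -
      logSlope p A B x t * (topCoeff p A B 2 x t + topCoeff p A (-B) 2 x t)) +
    logSlope' p A B x t * (topCoeff p A B 1 x t + topCoeff p A (-B) 1 x t) +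
    logSlope p A B x t ^ 3

theorem FlowNonzero.hasDerivAt_logSlope {x t : ℝ} (h : FlowNonzero p A B x t) :
    HasDerivAt (fun x => logSlope p A B x t) (logSlope' p A B x t) x := by
  have h1 := h.hasDerivAt_topCoeff 1
  have h2 := h.neg.hasDerivAt_topCoeff 1
  rw [neg_neg] at h2
  refine (h1.sub h2).congr_deriv ?_
  simp only [logSlope', logSlope]
  ring

/-- The cubic term appears because w + w⁻ has derivative (w - w⁻)². -/
theorem FlowNonzero.hasDerivAt_logSlope' {x t : ℝ} (h : FlowNonzero p A B x t) :
    HasDerivAt (fun x => logSlope' p A B x t) (logSlope'' p A B x t) x := by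
  have h1 := h.hasDerivAt_topCoeff 1
  have h1' := h.neg.hasDerivAt_topCoeff 1
  have h2 := h.hasDerivAt_topCoeff 2
  have h2' := h.neg.hasDerivAt_topCoeff 2
  rw [neg_neg] at h1' h2'
  refine (((h2'.sub h2).const_mul 2).add (h.hasDerivAt_logSlope.mul (h1.add h1'))).congr_deriv ?_
  simp only [logSlope'', logSlope', logSlope, Pi.add_apply]
  ring

theorem flowRatio_eq (hp : ∀ i, p i ≠ 0) (x t : ℝ) :
    flowRatio p A B x t = ((-1) ^ N * ∏ i, p i)⁻¹ * (flowWave p A B x t).coeff 0 := by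
  have hprod : (∏ i, p i) ≠ 0 := Finset.prod_ne_zero_iff.2 fun i _ => hp i
  rw [flowWave, coeff_wave_zero, flowRatio, altRatio,
    inv_mul_cancel_left₀ (mul_ne_zero (pow_ne_zero N (by norm_num)) hprod)]

theorem FlowNonzero.hasDerivAt_flowRatio_x {x t : ℝ} (hp : ∀ i, p i ≠ 0)
    (h : FlowNonzero p A B x t) :
    HasDerivAt (fun x => flowRatio p A B x t) (logSlope p A B x t * flowRatio p A B x t) x := by
  simp only [flowRatio_eq hp]
  refine (h.hasDerivAt_coeff_zero.const_mul _).congr_deriv ?_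
  rw [logSlope]
  ring

/-- The modified Korteweg-de Vries flow of the ratio of alternants. -/
theorem FlowNonzero.hasDerivAt_flowRatio_t {x t : ℝ} (hp : ∀ i, p i ≠ 0)
    (h : FlowNonzero p A B x t) :
    HasDerivAt (fun t => flowRatio p A B x t)
      ((-logSlope'' p A B x t + 2 * logSlope p A B x t ^ 3) * flowRatio p A B x t) t := by
  simp only [flowRatio_eq hp]
  refine (h.hasDerivAt_coeff_zero_t.const_mul _).congr_deriv ?_
  -- The x-derivatives of the top coefficients are replaced by the recursion, after which the claim
  -- is a polynomial identity in the top coefficients of Q and Q⁻.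
  have h1 := (h.coeffDeriv_x.2 1 N).unique (h.hasDerivAt_topCoeff 1)
  have h2 := (h.coeffDeriv_x.2 2 N).unique (h.hasDerivAt_topCoeff 2)
  rw [pow_one] at h1
  rw [h1, h2]
  simp only [logSlope'', logSlope', logSlope]
  ring

end Flow

/-! ### From ratios to phases and tangent equations -/

section Phase

/-- On `(e, m)` the ratio of alternants has the phase `-θ / 2`, up to the sign `s`. -/
def IsPhase {N : ℕ} (s : ℤˣ) (p e m : Fin N → ℂ) (θ : ℝ) : Prop :=
  AltNonzero p e m ∧ altRatio p e m = ((s : ℤ) : ℂ) * Complex.exp (-(Complex.I * θ / 2))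

theorem units_cast_mul_self (s : ℤˣ) : (((s : ℤ) : ℂ)) * ((s : ℤ) : ℂ) = 1 := by
  rcases Int.units_eq_one_or s with rfl | rfl <;> simp

variable {N : ℕ} {s : ℤˣ} {p e m : Fin N → ℂ} {θ : ℝ}

theorem IsPhase.neg (h : IsPhase s p e m θ) : IsPhase s p e (-m) (-θ) := by
  refine ⟨h.1.neg, ?_⟩
  rw [altRatio_neg, h.2, mul_inv, ← Complex.exp_neg,
    inv_eq_of_mul_eq_one_left (units_cast_mul_self s)]
  congr 2
  push_cast
  ring

theorem IsPhase.mul_row {κ : Fin N → ℂ} (hκ : ∀ i, κ i ≠ 0) (h : IsPhase s p e m θ) :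
    IsPhase s p (fun i => κ i * e i) (fun i => κ i * m i) θ :=
  ⟨h.1.mul_row hκ, by rw [altRatio_mul_row hκ, h.2]⟩

theorem exp_sub_exp_eq_sin (z : ℝ) :
    Complex.exp (Complex.I * z) - Complex.exp (-(Complex.I * z)) =
      2 * Complex.I * Real.sin z := by
  have h1 : Complex.I * z = z * Complex.I := mul_comm _ _
  have h2 : -(Complex.I * z) = ((-z : ℝ) : ℂ) * Complex.I := by push_cast; ring
  rw [h2, h1, Complex.exp_mul_I, Complex.exp_mul_I, ← Complex.ofReal_cos, ← Complex.ofReal_sin,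
    ← Complex.ofReal_cos, ← Complex.ofReal_sin, Real.cos_neg, Real.sin_neg]
  push_cast
  ring

theorem TanEq.neg {μ ε A B : ℝ} (h : TanEq μ ε (-A) (-B)) : TanEq μ ε A B := by
  obtain ⟨h1, h2⟩ := h
  simp only [Real.sin_neg, Real.cos_neg, Real.tan_neg] at h1 h2
  exact ⟨by linarith, fun h => by linarith [h2 h]⟩

/-- The trigonometric form of the quadratic relation between phases. -/
theorem tanEq_of_phases {μ ε θ₀₀ θ₁₀ θ₀₁ θ₁₁ : ℝ} {r₀₀ r₁₀ r₀₁ r₁₁ : ℂ}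
    (h₀₀ : r₀₀ = ((s : ℤ) : ℂ) * Complex.exp (-(Complex.I * θ₀₀ / 2)))
    (h₁₀ : r₁₀ = ((s : ℤ) : ℂ) * Complex.exp (-(Complex.I * θ₁₀ / 2)))
    (h₀₁ : r₀₁ = ((s : ℤ) : ℂ) * Complex.exp (-(Complex.I * θ₀₁ / 2)))
    (h₁₁ : r₁₁ = ((s : ℤ) : ℂ) * Complex.exp (-(Complex.I * θ₁₁ / 2)))
    (h : μ * (r₀₀ * r₀₁ - r₁₁ * r₁₀) = ε * (r₀₀ * r₁₀ - r₁₁ * r₀₁))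
    (hedge : μ = -ε → r₁₁ = r₀₀) :
    TanEq μ ε ((θ₁₁ - θ₀₀) / 4) ((θ₀₁ - θ₁₀) / 4) := by
  have hs := units_cast_mul_self s
  have hs0 : ((s : ℤ) : ℂ) ≠ 0 := left_ne_zero_of_mul_eq_one hs
  set A := (θ₁₁ - θ₀₀) / 4 with hA
  set B := (θ₀₁ - θ₁₀) / 4 with hB
  have hprod : ∀ x y : ℝ, ((s : ℤ) : ℂ) * Complex.exp (-(Complex.I * x / 2)) *
      (((s : ℤ) : ℂ) * Complex.exp (-(Complex.I * y / 2))) =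
      Complex.exp (-(Complex.I * (x + y) / 2)) := by
    intro x y
    rw [mul_mul_mul_comm, hs, one_mul, ← Complex.exp_add]
    congr 1
    ring
  have hdiff : ∀ x y : ℝ, Complex.exp (-(Complex.I * x / 2)) - Complex.exp (-(Complex.I * y / 2)) =
      Complex.exp (-(Complex.I * (x + y) / 4)) * (2 * Complex.I * Real.sin ((y - x) / 4)) := by
    intro x y
    rw [← exp_sub_exp_eq_sin, mul_sub, ← Complex.exp_add, ← Complex.exp_add]
    congr 2 <;> push_cast <;> ring
  rw [h₀₀, h₁₀, h₀₁, h₁₁] at h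
  simp only [hprod] at h
  -- Both differences carry the same phase factor, with a quarter of the sum of all four angles;
  -- cancelling it leaves μ sin(A - B) = ε sin(A + B).
  have d1 := hdiff (θ₀₀ + θ₀₁) (θ₁₁ + θ₁₀)
  have d2 := hdiff (θ₀₀ + θ₁₀) (θ₁₁ + θ₀₁)
  push_cast at d1 d2
  rw [d1, d2] at h
  have hE : Complex.exp (-(Complex.I * (θ₀₀ + θ₁₀ + (θ₁₁ + θ₀₁)) / 4)) =
      Complex.exp (-(Complex.I * (θ₀₀ + θ₀₁ + (θ₁₁ + θ₁₀)) / 4)) := by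
    congr 1; ring
  rw [hE] at h
  have h3 : (μ : ℂ) * Complex.sin ((θ₁₁ + θ₁₀ - (θ₀₀ + θ₀₁)) / 4) =
      ε * Complex.sin ((θ₁₁ + θ₀₁ - (θ₀₀ + θ₁₀)) / 4) := by
    refine mul_left_cancel₀ (mul_ne_zero (Complex.exp_ne_zero
      (-(Complex.I * (θ₀₀ + θ₀₁ + (θ₁₁ + θ₁₀)) / 4)))
      (mul_ne_zero two_ne_zero Complex.I_ne_zero)) ?_
    linear_combination h
  have h4 : μ * Real.sin (A - B) = ε * Real.sin (A + B) := by
    have e1 : A - B = (θ₁₁ + θ₁₀ - (θ₀₀ + θ₀₁)) / 4 := by rw [hA, hB]; ring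
    have e2 : A + B = (θ₁₁ + θ₀₁ - (θ₀₀ + θ₁₀)) / 4 := by rw [hA, hB]; ring
    rw [e1, e2]
    exact_mod_cast h3
  rw [Real.sin_sub, Real.sin_add] at h4
  have h5 : (μ - ε) * (Real.sin A * Real.cos B) = (μ + ε) * (Real.cos A * Real.sin B) := by
    linarith
  refine ⟨h5, fun hne => ?_⟩
  have hne' : μ - ε ≠ 0 := sub_ne_zero.2 hne
  have hA1 := Real.sin_sq_add_cos_sq A
  have hB1 := Real.sin_sq_add_cos_sq B
  rw [Real.tan_eq_sin_div_cos, Real.tan_eq_sin_div_cos]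
  -- Here cos B vanishes too, and both tangents take the default value 0.
  by_cases hcA : Real.cos A = 0
  · have hsA : Real.sin A ≠ 0 := fun h0 => by simp [h0, hcA] at hA1
    have hcB : Real.cos B = 0 := by
      rw [hcA, zero_mul, mul_zero] at h5
      simpa [hne', hsA] using h5
    simp [hcA, hcB]
  -- The cleared equation now gives μ + ε = 0 and nothing about A, while the default value of tan B
  -- demands tan A = 0. Equality of the opposite corner ratios supplies it.
  by_cases hcB : Real.cos B = 0
  · have hsB : Real.sin B ≠ 0 := fun h0 => by simp [h0, hcB] at hB1
    have hsum : μ + ε = 0 := by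
      rw [hcB, mul_zero, mul_zero] at h5
      simpa [hcA, hsB] using h5.symm
    have h6 := hedge (by linarith)
    rw [h₀₀, h₁₁] at h6
    have h7 := mul_left_cancel₀ hs0 h6
    have h8 : (2 * Complex.I * Real.sin A : ℂ) = 0 := by
      have := hdiff θ₀₀ θ₁₁
      rw [h7, sub_self, ← hA] at this
      exact (mul_eq_zero.1 this.symm).resolve_left (Complex.exp_ne_zero _)
    have h9 : Real.sin A = 0 := by
      simpa [-Complex.ofReal_sin] using h8
    rw [h9, hsum]
    simp
  · field_simp
    linarith

variable {e₀₀ m₀₀ e₁₀ m₁₀ e₀₁ m₀₁ e₁₁ m₁₁ : Fin N → ℂ}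

/-- The discrete potential mKdV equation on a square of lattice shifts. -/
theorem tanEq_of_square {a b θ₀₀ θ₁₀ θ₀₁ θ₁₁ : ℝ} (hp : ∀ i, p i ≠ 0)
    (ha₀ : IsShift a p e₀₀ m₀₀ e₁₀ m₁₀) (ha₁ : IsShift a p e₀₁ m₀₁ e₁₁ m₁₁)
    (hb₀ : IsShift b p e₀₀ m₀₀ e₀₁ m₀₁) (hb₁ : IsShift b p e₁₀ m₁₀ e₁₁ m₁₁)
    (h₀₀ : IsPhase s p e₀₀ m₀₀ θ₀₀) (h₁₀ : IsPhase s p e₁₀ m₁₀ θ₁₀)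
    (h₀₁ : IsPhase s p e₀₁ m₀₁ θ₀₁) (h₁₁ : IsPhase s p e₁₁ m₁₁ θ₁₁) :
    TanEq b a ((θ₁₁ - θ₀₀) / 4) ((θ₀₁ - θ₁₀) / 4) :=
  tanEq_of_phases h₀₀.2 h₁₀.2 h₀₁.2 h₁₁.2
    (altRatio_square hp ha₀ ha₁ hb₀ hb₁ h₀₀.1 h₁₀.1 h₀₁.1 h₁₁.1)
    -- If b = -a, the path through corner 10 consists of two opposite shifts.
    fun hba => by
      rw [hba] at hb₁
      exact altRatio_shift_shift_neg ha₀ hb₁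

/-- The discrete Bäcklund relation between `N` and `N + 1` rows. -/
theorem tanEq_of_append {p e m e' m' : Fin (N + 1) → ℂ} {a q θ₀ θ₁ φ₀ φ₁ : ℝ}
    (hp : ∀ i, p i ≠ 0) (hq : p (Fin.last N) = q) (hs : IsShift a p e m e' m')
    (h₀ : IsPhase s (fun i : Fin N => p i.castSucc) (fun i => e i.castSucc)
      (fun i => m i.castSucc) θ₀)
    (h₁ : IsPhase s (fun i : Fin N => p i.castSucc) (fun i => e' i.castSucc)
      (fun i => m' i.castSucc) θ₁)
    (h₀' : IsPhase s p e m φ₀) (h₁' : IsPhase s p e' m' φ₁) :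
    TanEq (1 / -q) a ((φ₁ - θ₀) / 4) ((φ₀ - θ₁) / 4) := by
  have hq0 : (q : ℂ) ≠ 0 := hq ▸ hp _
  refine tanEq_of_phases h₀.2 h₁.2 h₀'.2 h₁'.2 ?_ fun hba => ?_
  · rw [altRatio_append_square hp hs h₀.1 h₁.1 h₀'.1 h₁'.1, hq]
    push_cast
    field_simp
  -- The degenerate case would mean a q = 1, a vanishing denominator of the shift.
  · refine absurd ?_ (hs (Fin.last N)).2.2.1
    have hq0' : q ≠ 0 := by exact_mod_cast hq0
    have : 1 - a * q = 0 := by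
      field_simp at hba
      linarith
    rw [hq]
    exact_mod_cast this

end Phase

/-! ### Smoothness of branches; the t-part of the transformation from its x-part -/

section Calculus

/-- A real function that agrees with a differentiable complex one has the same derivative. -/
theorem hasDerivAt_of_ofReal_eq {g : ℝ → ℝ} {G : ℝ → ℂ} {G' : ℂ} {x : ℝ}
    (h : ∀ᶠ y in nhds x, (g y : ℂ) = G y) (hG : HasDerivAt G G' x) :
    HasDerivAt g (deriv g x) x ∧ ((deriv g x : ℝ) : ℂ) = G' := by
  have h1 : HasDerivAt (fun y => (G y).re) G'.re x :=
    (Complex.reCLM.hasFDerivAt (x := G x)).comp_hasDerivAt x hG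
  have h2 : HasDerivAt (fun y => (G y).im) G'.im x :=
    (Complex.imCLM.hasFDerivAt (x := G x)).comp_hasDerivAt x hG
  have h3 : HasDerivAt g G'.re x :=
    h1.congr_of_eventuallyEq (h.mono fun y hy => by simp [← hy])
  have h4 : G'.im = 0 := (h2.congr_of_eventuallyEq (f₁ := fun _ => (0 : ℝ))
    (h.mono fun y hy => by simp [← hy])).unique (hasDerivAt_const x 0)
  rw [h3.deriv]
  exact ⟨h3, Complex.ext (by simp) (by simp [h4])⟩

/-- A continuous branch of the logarithm of a smooth function is smooth. -/
theorem contDiffAt_of_exp_eq {E : Type*} [NormedAddCommGroup E] [NormedSpace ℝ E]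
    {n : WithTop ℕ∞} {θ : E → ℝ} {g : E → ℂ} {z : E} (hθ : ContinuousAt θ z)
    (hg : ContDiffAt ℝ n g z)
    (h : ∀ᶠ w in nhds z, Complex.exp (-(Complex.I * θ w / 2)) = g w) : ContDiffAt ℝ n θ z := by
  have hz : g z = Complex.exp (-(Complex.I * θ z / 2)) := h.self_of_nhds.symm
  have hz0 : g z ≠ 0 := hz ▸ Complex.exp_ne_zero _
  -- Dividing by the value at z moves the argument to 1, away from the cut of the principal
  -- logarithm.
  have hlog : ContDiffAt ℝ n (fun w => Complex.log (g w / g z)) z := by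
    refine ContDiffAt.comp z (g := Complex.log) ?_ (hg.div_const _)
    rw [div_self hz0]
    exact (Complex.contDiffAt_log (by simp)).restrict_scalars ℝ
  have him : ContDiffAt ℝ n (fun w => θ z - 2 * (Complex.log (g w / g z)).im) z :=
    contDiffAt_const.sub (contDiffAt_const.mul
      (Complex.imCLM.contDiff.contDiffAt.comp z hlog))
  refine him.congr_of_eventuallyEq ?_
  -- With |θ w - θ z| < 1 the exponent has imaginary part below 1/2 in absolute value, so the
  -- principal logarithm recovers it.
  have hnear : ∀ᶠ w in nhds z, |θ w - θ z| < 1 := by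
    have := Metric.continuousAt_iff'.1 hθ 1 one_pos
    simpa [Real.dist_eq] using this
  filter_upwards [h, hnear] with w hw hw1
  have hpi := Real.pi_gt_three
  have hab := abs_lt.1 hw1
  have e1 : g w / g z = Complex.exp ((-(θ w - θ z) / 2 : ℝ) * Complex.I) := by
    rw [← hw, hz, ← Complex.exp_sub]
    congr 1
    push_cast
    ring
  rw [e1, Complex.log_exp (by simp; linarith) (by simp; linarith)]
  simp
  ring

theorem eventually_slice_x {U : Set (ℝ × ℝ)} (hU : IsOpen U) {x t : ℝ} (h : (x, t) ∈ U) :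
    ∀ᶠ y in nhds x, (y, t) ∈ U :=
  (Continuous.prodMk continuous_id continuous_const).continuousAt.eventually
    (f := fun y : ℝ => (y, t)) (hU.mem_nhds h)

theorem eventually_slice_t {U : Set (ℝ × ℝ)} (hU : IsOpen U) {x t : ℝ} (h : (x, t) ∈ U) :
    ∀ᶠ y in nhds t, (x, y) ∈ U :=
  (Continuous.prodMk continuous_const continuous_id).continuousAt.eventually
    (f := fun y : ℝ => (x, y)) (hU.mem_nhds h)

theorem SolvesPmKdV.contDiffAt_x {U : Set (ℝ × ℝ)} (hU : IsOpen U) {θ : ℝ → ℝ → ℝ}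
    (h : SolvesPmKdV U θ) {x t : ℝ} (hx : (x, t) ∈ U) {n : ℕ} :
    ContDiffAt ℝ n (fun x => θ x t) x :=
  ((h.1.contDiffAt (hU.mem_nhds hx)).of_le (by exact_mod_cast le_top)).comp x
    (f := fun y : ℝ => (y, t)) (by fun_prop)

theorem SolvesPmKdV.hasDerivAt_t {U : Set (ℝ × ℝ)} (hU : IsOpen U) {θ : ℝ → ℝ → ℝ}
    (h : SolvesPmKdV U θ) {x t : ℝ} (hx : (x, t) ∈ U) :
    HasDerivAt (fun t => θ x t) (dT θ x t) t :=
  (((h.1.contDiffAt (hU.mem_nhds hx)).of_le (m := 1) (by exact_mod_cast le_top)).comp t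
    (f := fun y : ℝ => (x, y)) (by fun_prop)).differentiableAt one_ne_zero |>.hasDerivAt

theorem SolvesPmKdV.hasDerivAt_x {U : Set (ℝ × ℝ)} (hU : IsOpen U) {θ : ℝ → ℝ → ℝ}
    (h : SolvesPmKdV U θ) {x t : ℝ} (hx : (x, t) ∈ U) :
    HasDerivAt (fun x => θ x t) (dX θ x t) x :=
  ((h.contDiffAt_x hU hx (n := 1)).differentiableAt one_ne_zero).hasDerivAt

theorem ContDiffAt.deriv_real {f : ℝ → ℝ} {x : ℝ} {n : ℕ}
    (h : ContDiffAt ℝ (n + 1 : ℕ) f x) : ContDiffAt ℝ n (deriv f) x := by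
  have := h.fderiv_right (m := n) (by norm_cast)
  exact this.clm_apply contDiffAt_const

theorem SolvesPmKdV.hasDerivAt_xx {U : Set (ℝ × ℝ)} (hU : IsOpen U) {θ : ℝ → ℝ → ℝ}
    (h : SolvesPmKdV U θ) {x t : ℝ} (hx : (x, t) ∈ U) :
    HasDerivAt (fun x => dX θ x t) (dX (dX θ) x t) x :=
  ((h.contDiffAt_x hU hx (n := 2)).deriv_real.differentiableAt (n := (1 : ℕ))
    (by norm_num)).hasDerivAt

theorem SolvesPmKdV.hasDerivAt_xxx {U : Set (ℝ × ℝ)} (hU : IsOpen U) {θ : ℝ → ℝ → ℝ}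
    (h : SolvesPmKdV U θ) {x t : ℝ} (hx : (x, t) ∈ U) :
    HasDerivAt (fun x => dX (dX θ) x t) (dX (dX (dX θ)) x t) x :=
  ((h.contDiffAt_x hU hx (n := 3)).deriv_real.deriv_real.differentiableAt (n := (1 : ℕ))
    (by norm_num)).hasDerivAt

/-- The `x`-part of the Bäcklund transformation between two solutions implies the `t`-part. -/
theorem PmKdVBacklund.of_eq_x {U : Set (ℝ × ℝ)} (hU : IsOpen U) {lam : ℝ} {θ θ' : ℝ → ℝ → ℝ}
    (hlam : lam ≠ 0) (h : SolvesPmKdV U θ) (h' : SolvesPmKdV U θ')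
    (hx : ∀ x t, (x, t) ∈ U → dX θ' x t + dX θ x t = 4 * lam * Real.sin ((θ' x t - θ x t) / 2)) :
    PmKdVBacklund U lam θ θ' := by
  refine ⟨hlam, h, h', fun x t hxt => ?_, fun x t hxt => ?_⟩
  · have : HasDerivAt (fun x => (θ' x t + θ x t) / 2) ((dX θ' x t + dX θ x t) / 2) x :=
      ((h'.hasDerivAt_x hU hxt).add (h.hasDerivAt_x hU hxt)).div_const 2
    rw [dX, this.deriv, hx x t hxt]
    ring
  · have ht : HasDerivAt (fun t => (θ' x t + θ x t) / 2) ((dT θ' x t + dT θ x t) / 2) t :=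
      ((h'.hasDerivAt_t hU hxt).add (h.hasDerivAt_t hU hxt)).div_const 2
    have harg : ∀ y, (y, t) ∈ U → HasDerivAt (fun y => (θ' y t - θ y t) / 2)
        (2 * lam * Real.sin ((θ' y t - θ y t) / 2) - dX θ y t) y := fun y hy => by
      refine (((h'.hasDerivAt_x hU hy).sub (h.hasDerivAt_x hU hy)).div_const 2).congr_deriv ?_
      linear_combination hx y t hy / 2
    have hev := eventually_slice_x hU hxt
    have hxx : ∀ y, (y, t) ∈ U → dX (dX θ') y t + dX (dX θ) y t =
        4 * lam * (Real.cos ((θ' y t - θ y t) / 2) *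
          (2 * lam * Real.sin ((θ' y t - θ y t) / 2) - dX θ y t)) := fun y hy => by
      have h1 := (h'.hasDerivAt_xx hU hy).add (h.hasDerivAt_xx hU hy)
      have h2 := (harg y hy).sin.const_mul (4 * lam)
      exact h1.unique (h2.congr_of_eventuallyEq
        ((eventually_slice_x hU hy).mono fun z hz => hx z t hz))
    -- Two differentiations of the x-part give the sum of the third derivatives; the evolution
    -- equations trade that sum for the sum of the t-derivatives.
    have hxxx := ((h'.hasDerivAt_xxx hU hxt).add (h.hasDerivAt_xxx hU hxt)).unique
      ((((harg x hxt).cos.mul (((harg x hxt).sin.const_mul (2 * lam)).sub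
        (h.hasDerivAt_xx hU hxt))).const_mul (4 * lam)).congr_of_eventuallyEq
          (hev.mono fun z hz => hxx z hz))
    have e1 := h.2 x t hxt
    have e2 := h'.2 x t hxt
    have e3 : dX θ' x t = 4 * lam * Real.sin ((θ' x t - θ x t) / 2) - dX θ x t := by
      linarith [hx x t hxt]
    have hsc := Real.sin_sq_add_cos_sq ((θ' x t - θ x t) / 2)
    rw [dT, ht.deriv]
    simp only [Pi.sub_apply] at hxxx
    rw [e3] at e2
    generalize Real.sin ((θ' x t - θ x t) / 2) = S at *
    generalize Real.cos ((θ' x t - θ x t) / 2) = K at *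
    linear_combination e1 / 2 + e2 / 2 - hxxx / 2 +
      (4 * lam ^ 2 * dX θ x t - 8 * lam ^ 3 * S) * hsc

/-- Changing the sign of the second solution turns the first kind of Bäcklund transform into the
second kind. -/
theorem PmKdVBacklund.bar {U : Set (ℝ × ℝ)} {lam : ℝ} {θ θ' : ℝ → ℝ → ℝ}
    (h : PmKdVBacklund U lam θ fun x t => -θ' x t) (h' : SolvesPmKdV U θ') :
    PmKdVBacklundBar U lam θ θ' := by
  have e1 : ∀ x t, (-θ' x t + θ x t) / 2 = -((θ' x t - θ x t) / 2) := fun x t => by ring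
  have e2 : ∀ x t, (-θ' x t - θ x t) / 2 = -((θ' x t + θ x t) / 2) := fun x t => by ring
  refine ⟨h.lam_ne, h.solves, h', fun x t hxt => ?_, fun x t hxt => ?_⟩
  · have := h.eq_x x t hxt
    simp only [e1, e2, Real.sin_neg, dX, deriv.fun_neg] at this
    simp only [dX]
    linarith
  · have := h.eq_t x t hxt
    simp only [e1, e2, Real.sin_neg, Real.cos_neg, dT, deriv.fun_neg] at this
    simp only [dT]
    linarith

end Calculus

/-! ### Continuous potentials: mKdV and Bäcklund transforms -/

section FlowPhase

variable {N N' : ℕ} {s s' : ℤˣ} {p A B : Fin N → ℂ} {p' A' B' : Fin N' → ℂ} {U : Set (ℝ × ℝ)}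
  {θ θ' : ℝ → ℝ → ℝ}

/-- `θ` is a continuous phase on `U` of the ratio of alternants along the flow. -/
def IsFlowPhase (s : ℤˣ) (p A B : Fin N → ℂ) (U : Set (ℝ × ℝ)) (θ : ℝ → ℝ → ℝ) : Prop :=
  ContinuousOn (fun q : ℝ × ℝ => θ q.1 q.2) U ∧
    ∀ x t, (x, t) ∈ U → IsPhase s p (planeWave A p x t) (planeWave B (-p) x t) (θ x t)

theorem IsFlowPhase.neg (h : IsFlowPhase s p A B U θ) :
    IsFlowPhase s p A (-B) U fun x t => -θ x t :=
  ⟨h.1.neg, fun x t hxt => by rw [planeWave_neg]; exact (h.2 x t hxt).neg⟩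

theorem IsFlowPhase.flowRatio (h : IsFlowPhase s p A B U θ) {x t : ℝ} (hxt : (x, t) ∈ U) :
    flowRatio p A B x t = ((s : ℤ) : ℂ) * Complex.exp (-(Complex.I * θ x t / 2)) :=
  (h.2 x t hxt).2

theorem IsFlowPhase.exp_eq (h : IsFlowPhase s p A B U θ) {x t : ℝ} (hxt : (x, t) ∈ U) :
    Complex.exp (-(Complex.I * θ x t / 2)) = ((s : ℤ) : ℂ) * _root_.flowRatio p A B x t := by
  rw [h.flowRatio hxt, ← mul_assoc, units_cast_mul_self, one_mul]

theorem IsFlowPhase.contDiffOn (hU : IsOpen U) (h : IsFlowPhase s p A B U θ)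
    {n : WithTop ℕ∞} : ContDiffOn ℝ n (fun q : ℝ × ℝ => θ q.1 q.2) U := by
  intro z hz
  refine (contDiffAt_of_exp_eq (g := fun q : ℝ × ℝ =>
    ((s : ℤ) : ℂ) * _root_.flowRatio p A B q.1 q.2) (h.1.continuousAt (hU.mem_nhds hz)) ?_
    ?_).contDiffWithinAt
  · have h2 := contDiff_altDet (p := p) (A := A) (B := -B) (n := n)
    simp only [planeWave_neg] at h2
    have h1 := contDiff_altDet (p := p) (A := A) (B := B) (n := n)
    have h3 := h2.contDiffAt.mul (h1.contDiffAt.inv (x := z) (h.2 z.1 z.2 hz).1.1)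
    simp only [_root_.flowRatio, altRatio, div_eq_mul_inv]
    exact contDiffAt_const.mul h3
  · filter_upwards [hU.mem_nhds hz] with w hw using h.exp_eq hw

theorem IsFlowPhase.dX_eq (hp : ∀ i, p i ≠ 0) (hU : IsOpen U) (h : IsFlowPhase s p A B U θ)
    {x t : ℝ} (hxt : (x, t) ∈ U) :
    HasDerivAt (fun x => θ x t) (dX θ x t) x ∧
      (dX θ x t : ℂ) = 2 * Complex.I * logSlope p A B x t := by
  have hd : HasDerivAt (fun x => θ x t) (dX θ x t) x :=
    (((h.contDiffOn hU (n := 1)).contDiffAt (hU.mem_nhds hxt)).comp x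
      (f := fun y : ℝ => (y, t)) (by fun_prop)).differentiableAt one_ne_zero |>.hasDerivAt
  refine ⟨hd, ?_⟩
  have h1 := (FlowNonzero.hasDerivAt_flowRatio_x hp (h.2 x t hxt).1).const_mul ((s : ℤ) : ℂ)
  have h2 := ((hd.ofReal_comp.const_mul Complex.I).div_const 2).neg.cexp
  have h3 := h2.unique (h1.congr_of_eventuallyEq
    ((eventually_slice_x hU hxt).mono fun y hy => h.exp_eq hy))
  have h4 : Complex.exp (-(Complex.I * θ x t / 2)) * (-(Complex.I * dX θ x t / 2)) =
      Complex.exp (-(Complex.I * θ x t / 2)) * logSlope p A B x t := by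
    refine h3.trans ?_
    rw [h.exp_eq hxt]
    ring
  have h5 := mul_left_cancel₀ (Complex.exp_ne_zero _) h4
  linear_combination 2 * Complex.I * h5 + dX θ x t * Complex.I_sq

theorem IsFlowPhase.dT_eq (hp : ∀ i, p i ≠ 0) (hU : IsOpen U) (h : IsFlowPhase s p A B U θ)
    {x t : ℝ} (hxt : (x, t) ∈ U) :
    (dT θ x t : ℂ) = 2 * Complex.I * (-logSlope'' p A B x t + 2 * logSlope p A B x t ^ 3) := by
  have hd : HasDerivAt (fun t => θ x t) (dT θ x t) t :=
    (((h.contDiffOn hU (n := 1)).contDiffAt (hU.mem_nhds hxt)).comp t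
      (f := fun y : ℝ => (x, y)) (by fun_prop)).differentiableAt one_ne_zero |>.hasDerivAt
  have h1 := (FlowNonzero.hasDerivAt_flowRatio_t hp (h.2 x t hxt).1).const_mul ((s : ℤ) : ℂ)
  have h2 := ((hd.ofReal_comp.const_mul Complex.I).div_const 2).neg.cexp
  have h3 := h2.unique (h1.congr_of_eventuallyEq
    ((eventually_slice_t hU hxt).mono fun y hy => h.exp_eq hy))
  have h4 : Complex.exp (-(Complex.I * θ x t / 2)) * (-(Complex.I * dT θ x t / 2)) =
      Complex.exp (-(Complex.I * θ x t / 2)) *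
        (-logSlope'' p A B x t + 2 * logSlope p A B x t ^ 3) := by
    refine h3.trans ?_
    rw [h.exp_eq hxt]
    ring
  have h5 := mul_left_cancel₀ (Complex.exp_ne_zero _) h4
  linear_combination 2 * Complex.I * h5 + dT θ x t * Complex.I_sq

/-- Phases of ratios of alternants solve the potential mKdV equation. -/
theorem IsFlowPhase.solvesPmKdV (hp : ∀ i, p i ≠ 0) (hU : IsOpen U)
    (h : IsFlowPhase s p A B U θ) : SolvesPmKdV U θ := by
  refine ⟨h.contDiffOn hU, fun x t hxt => ?_⟩
  have hxx : ∀ y, (y, t) ∈ U →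
      ((dX (dX θ) y t : ℝ) : ℂ) = 2 * Complex.I * logSlope' p A B y t := fun y hy =>
    (hasDerivAt_of_ofReal_eq ((eventually_slice_x hU hy).mono fun z hz => (h.dX_eq hp hU hz).2)
      ((FlowNonzero.hasDerivAt_logSlope (h.2 y t hy).1).const_mul _)).2
  have hxxx : ((dX (dX (dX θ)) x t : ℝ) : ℂ) = 2 * Complex.I * logSlope'' p A B x t :=
    (hasDerivAt_of_ofReal_eq ((eventually_slice_x hU hxt).mono fun z hz => hxx z hz)
      ((FlowNonzero.hasDerivAt_logSlope' (h.2 x t hxt).1).const_mul _)).2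
  have h1 := (h.dX_eq hp hU hxt).2
  have h3 := h.dT_eq hp hU hxt
  have : ((dT θ x t + 1 / 2 * (dX θ x t) ^ 3 + dX (dX (dX θ)) x t : ℝ) : ℂ) = 0 := by
    push_cast
    rw [h1, h3, hxxx]
    linear_combination 4 * Complex.I * logSlope p A B x t ^ 3 * Complex.I_sq
  exact_mod_cast this

/-- The bilinear relation between logarithmic slopes yields a Bäcklund transform. -/
theorem IsFlowPhase.pmKdVBacklund (hp : ∀ i, p i ≠ 0) (hp' : ∀ i, p' i ≠ 0) (hU : IsOpen U)
    (h : IsFlowPhase s p A B U θ) (h' : IsFlowPhase s p' A' B' U θ') {lam : ℝ} (hlam : lam ≠ 0)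
    (hrel : ∀ x t, (x, t) ∈ U → logSlope p A B x t + logSlope p' A' B' x t =
      lam * (_root_.flowRatio p' A' B' x t / _root_.flowRatio p A B x t -
        _root_.flowRatio p A B x t / _root_.flowRatio p' A' B' x t)) :
    PmKdVBacklund U lam θ θ' := by
  refine PmKdVBacklund.of_eq_x hU hlam (h.solvesPmKdV hp hU) (h'.solvesPmKdV hp' hU)
    fun x t hxt => ?_
  have h1 := (h.dX_eq hp hU hxt).2
  have h1' := (h'.dX_eq hp' hU hxt).2
  have hr := hrel x t hxt
  have hs0 : ((s : ℤ) : ℂ) ≠ 0 := left_ne_zero_of_mul_eq_one (units_cast_mul_self s)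
  rw [h.flowRatio hxt, h'.flowRatio hxt, mul_div_mul_left _ _ hs0, mul_div_mul_left _ _ hs0,
    ← Complex.exp_sub, ← Complex.exp_sub] at hr
  have e := exp_sub_exp_eq_sin ((θ' x t - θ x t) / 2)
  have e1 : -(Complex.I * θ x t / 2) - -(Complex.I * θ' x t / 2) =
      Complex.I * (((θ' x t - θ x t) / 2 : ℝ) : ℂ) := by push_cast; ring
  have e2 : -(Complex.I * θ' x t / 2) - -(Complex.I * θ x t / 2) =
      -(Complex.I * (((θ' x t - θ x t) / 2 : ℝ) : ℂ)) := by push_cast; ring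
  rw [e1, e2] at hr
  have : ((dX θ' x t + dX θ x t : ℝ) : ℂ) =
      ((4 * lam * Real.sin ((θ' x t - θ x t) / 2) : ℝ) : ℂ) := by
    rw [Complex.ofReal_add, Complex.ofReal_mul, Complex.ofReal_mul]
    rw [h1, h1']
    have h4 : ((4 : ℝ) : ℂ) = 4 := by norm_num
    rw [h4]
    linear_combination 2 * Complex.I * hr - 2 * Complex.I * lam * e -
      4 * lam * Real.sin ((θ' x t - θ x t) / 2) * Complex.I_sq
  exact_mod_cast this

theorem IsShift.planeWave {c : ℝ} {A₁ B₁ : Fin N → ℂ} (h : IsShift c p A B A₁ B₁) (x t : ℝ) :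
    IsShift c p (planeWave A p x t) (planeWave B (-p) x t) (planeWave A₁ p x t)
      (planeWave B₁ (-p) x t) := by
  intro i
  obtain ⟨h1, h2, h3⟩ := h i
  refine ⟨?_, ?_, h3⟩
  · simp only [_root_.planeWave]
    rw [← h1]; ring
  · simp only [_root_.planeWave]
    rw [← h2]; ring

theorem logSlope_eq (x t : ℝ) : logSlope p A B x t =
    waveSub p (planeWave A p x t) (planeWave B (-p) x t) -
      waveSub p (planeWave A p x t) (-planeWave B (-p) x t) := by
  rw [logSlope, topCoeff_one, topCoeff_one, planeWave_neg]

/-- A lattice shift is a Bäcklund transformation of the potential mKdV equation. -/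
theorem IsFlowPhase.backlund_of_shift {c : ℝ} {A₁ B₁ : Fin N → ℂ} (hp : ∀ i, p i ≠ 0)
    (hU : IsOpen U) (hc : c ≠ 0) (hs : IsShift c p A B A₁ B₁) (h : IsFlowPhase s p A B U θ)
    (h' : IsFlowPhase s p A₁ B₁ U θ') : PmKdVBacklund U (1 / c) θ θ' := by
  refine h.pmKdVBacklund hp hp hU h' (one_div_ne_zero hc) fun x t hxt => ?_
  have hsx := hs.planeWave x t
  have n := (h.2 x t hxt).1
  have n' := (h'.2 x t hxt).1
  -- The difference of the relations for m and -m is c(v + v') = r'/r - r/r'.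
  have k1 := hsx.waveSub_relation hp n n'
  have k2 := hsx.neg.waveSub_relation hp n.neg n'.neg
  rw [neg_neg, altRatio_neg, altRatio_neg, inv_div_inv] at k2
  rw [logSlope_eq, logSlope_eq]
  have hc' : (c : ℂ) ≠ 0 := by exact_mod_cast hc
  unfold _root_.flowRatio
  push_cast
  refine mul_left_cancel₀ hc' ?_
  rw [← mul_assoc, mul_one_div_cancel hc']
  linear_combination k1 - k2

/-- Appending a row is a Bäcklund transformation of the potential mKdV equation. -/
theorem IsFlowPhase.backlund_of_append {p A B : Fin (N + 1) → ℂ} {q : ℝ} (hp : ∀ i, p i ≠ 0)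
    (hU : IsOpen U) (hq : p (Fin.last N) = q)
    (h : IsFlowPhase s (fun i : Fin N => p i.castSucc) (fun i => A i.castSucc)
      (fun i => B i.castSucc) U θ)
    (h' : IsFlowPhase s p A B U θ') : PmKdVBacklund U (-q) θ θ' := by
  have hq0 : q ≠ 0 := fun h0 => hp (Fin.last N) (by rw [hq, h0]; simp)
  refine h.pmKdVBacklund (fun i => hp _) hp hU h' (neg_ne_zero.2 hq0) fun x t hxt => ?_
  have n : AltNonzero (fun i : Fin N => p i.castSucc) (fun i => planeWave A p x t i.castSucc)
      (fun i => planeWave B (-p) x t i.castSucc) := (h.2 x t hxt).1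
  -- In v + v' the subleading coefficients of the first N rows cancel, leaving -q(r'/r - r/r').
  have k1 := waveSub_append hp n (h'.2 x t hxt).1
  have k2 := waveSub_append_neg hp n (h'.2 x t hxt).1
  rw [logSlope_eq, logSlope_eq, k1, k2, hq, Complex.ofReal_neg]
  have e1 : planeWave (fun i : Fin N => A i.castSucc) (fun i => p i.castSucc) x t =
      fun i => planeWave A p x t i.castSucc := rfl
  have e2 : planeWave (fun i : Fin N => B i.castSucc) (-fun i => p i.castSucc) x t =
      fun i => planeWave B (-p) x t i.castSucc := rfl
  simp only [_root_.flowRatio]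
  rw [e1, e2]
  ring

end FlowPhase

/-! ### Lattice potentials: discrete mKdV and Bäcklund transforms -/

section Lattice

variable {N : ℕ} {s : ℤˣ} {p : Fin N → ℂ} {a b : ℤ → ℝ} {E M E' M' : ℤ → ℤ → Fin N → ℂ}
  {S : Set (ℤ × ℤ)} {Θ Θ' : ℤ → ℤ → ℝ}

/-- `(E, M)` is a family of data on the lattice, related by shifts with parameters `a`, `b`. -/
structure IsLatticeWave (a b : ℤ → ℝ) (p : Fin N → ℂ) (E M : ℤ → ℤ → Fin N → ℂ) : Prop where
  shift_n : ∀ n m, IsShift (a n) p (E n m) (M n m) (E (n + 1) m) (M (n + 1) m)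
  shift_m : ∀ n m, IsShift (b m) p (E n m) (M n m) (E n (m + 1)) (M n (m + 1))

/-- `Θ` is a phase of the ratio of alternants at the sites in `S`. -/
def IsLatticePhase (s : ℤˣ) (p : Fin N → ℂ) (E M : ℤ → ℤ → Fin N → ℂ) (S : Set (ℤ × ℤ))
    (Θ : ℤ → ℤ → ℝ) : Prop :=
  ∀ n m, (n, m) ∈ S → IsPhase s p (E n m) (M n m) (Θ n m)

theorem IsLatticePhase.solvesDpmKdV (hp : ∀ i, p i ≠ 0) (hw : IsLatticeWave a b p E M)
    (h : IsLatticePhase s p E M S Θ) : SolvesDpmKdV S a b Θ :=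
  fun _ _ h₀₀ h₁₀ h₀₁ h₁₁ =>
    tanEq_of_square hp (hw.shift_n _ _) (hw.shift_n _ _) (hw.shift_m _ _) (hw.shift_m _ _)
      (h _ _ h₀₀) (h _ _ h₁₀) (h _ _ h₀₁) (h _ _ h₁₁)

/-- A lattice shift in a further direction is a Bäcklund transformation. -/
theorem IsLatticePhase.backlund_of_shift {c : ℝ} (hp : ∀ i, p i ≠ 0) (hc : c ≠ 0)
    (hw : IsLatticeWave a b p E M) (hw' : IsLatticeWave a b p E' M')
    (hs : ∀ n m, IsShift c p (E n m) (M n m) (E' n m) (M' n m))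
    (h : IsLatticePhase s p E M S Θ) (h' : IsLatticePhase s p E' M' S Θ') :
    DpmKdVBacklund S a b (1 / c) Θ Θ' where
  lam_ne := one_div_ne_zero hc
  solves := h.solvesDpmKdV hp hw
  solves' := h'.solvesDpmKdV hp hw'
  eq_n n m h₀ h₁ := by
    -- The Bäcklund direction plays the part of a second lattice direction with parameter c.
    rw [one_div_one_div]
    exact tanEq_of_square hp (hw.shift_n _ _) (hw'.shift_n _ _) (hs _ _) (hs _ _)
      (h _ _ h₀) (h _ _ h₁) (h' _ _ h₀) (h' _ _ h₁)
  eq_m n m h₀ h₁ := by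
    rw [one_div_one_div]
    exact tanEq_of_square hp (hw.shift_m _ _) (hw'.shift_m _ _) (hs _ _) (hs _ _)
      (h _ _ h₀) (h _ _ h₁) (h' _ _ h₀) (h' _ _ h₁)

/-- Appending a row is a Bäcklund transformation of the discrete equation. -/
theorem IsLatticePhase.backlund_of_append {p : Fin (N + 1) → ℂ} {E M : ℤ → ℤ → Fin (N + 1) → ℂ}
    {q : ℝ} (hp : ∀ i, p i ≠ 0) (hq : p (Fin.last N) = q) (hw : IsLatticeWave a b p E M)
    (h : IsLatticePhase s (fun i : Fin N => p i.castSucc) (fun n m i => E n m i.castSucc)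
      (fun n m i => M n m i.castSucc) S Θ)
    (h' : IsLatticePhase s p E M S Θ') : DpmKdVBacklund S a b (-q) Θ Θ' where
  lam_ne := neg_ne_zero.2 fun h0 => hp (Fin.last N) (by rw [hq, h0]; simp)
  solves := IsLatticePhase.solvesDpmKdV (p := fun i : Fin N => p i.castSucc)
    (E := fun n m i => E n m i.castSucc) (M := fun n m i => M n m i.castSucc) (fun i => hp _)
    ⟨fun n m i => hw.shift_n n m _, fun n m i => hw.shift_m n m _⟩ h
  solves' := h'.solvesDpmKdV hp hw
  eq_n n m h₀ h₁ := tanEq_of_append hp hq (hw.shift_n n m) (h _ _ h₀) (h _ _ h₁) (h' _ _ h₀)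
    (h' _ _ h₁)
  eq_m n m h₀ h₁ := tanEq_of_append hp hq (hw.shift_m n m) (h _ _ h₀) (h _ _ h₁) (h' _ _ h₀)
    (h' _ _ h₁)

/-- Changing the sign of the second solution turns the first kind of Bäcklund transform into the
second kind. -/
theorem DpmKdVBacklund.bar {lam : ℝ} (h : DpmKdVBacklund S a b lam Θ fun n m => -Θ' n m)
    (h' : SolvesDpmKdV S a b Θ') : DpmKdVBacklundBar S a b lam Θ Θ' where
  lam_ne := h.lam_ne
  solves := h.solves
  solves' := h'
  eq_n n m h₀ h₁ := by
    refine TanEq.neg ?_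
    convert h.eq_n n m h₀ h₁ using 1 <;> ring
  eq_m n m h₀ h₁ := by
    refine TanEq.neg ?_
    convert h.eq_m n m h₀ h₁ using 1 <;> ring

theorem IsShift.mul_row {c : ℝ} {e m e' m' κ : Fin N → ℂ} (h : IsShift c p e m e' m') :
    IsShift c p (fun i => κ i * e i) (fun i => κ i * m i) (fun i => κ i * e' i)
      (fun i => κ i * m' i) := fun i => by
  refine ⟨?_, ?_, (h i).2.2⟩
  · beta_reduce
    rw [← (h i).1]; ring
  · beta_reduce
    rw [← (h i).2.1]; ring

theorem planeWave_mul_row (κ A q : Fin N → ℂ) (x t : ℝ) :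
    planeWave (fun i => κ i * A i) q x t = fun i => κ i * planeWave A q x t i := by
  funext i
  simp only [planeWave, mul_assoc]

theorem IsLatticeWave.mul_row_neg {κ : Fin N → ℂ} (h : IsLatticeWave a b p E M) :
    IsLatticeWave a b p (fun n m i => κ i * E n m i) (fun n m i => κ i * (-M n m) i) :=
  ⟨fun n m => (h.shift_n n m).neg.mul_row, fun n m => (h.shift_m n m).neg.mul_row⟩

theorem IsLatticeWave.planeWave (h : IsLatticeWave a b p E M) (x t : ℝ) :
    IsLatticeWave a b p (fun n m => planeWave (E n m) p x t)
      (fun n m => planeWave (M n m) (-p) x t) :=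
  ⟨fun n m => (h.shift_n n m).planeWave x t, fun n m => (h.shift_m n m).planeWave x t⟩

end Lattice

/-! ### Complex conjugation of the data -/

section Reality

variable {N : ℕ} {p A B : Fin N → ℂ}

/-- Complex conjugation acts on the data by the permutation `σ`, up to the sign of `B`. -/
def IsRealData (σ : Equiv.Perm (Fin N)) (p A B : Fin N → ℂ) : Prop :=
  ∀ i, p (σ i) = conj (p i) ∧ A (σ i) = conj (A i) ∧ B (σ i) = -conj (B i)

theorem IsRealData.planeWave {σ : Equiv.Perm (Fin N)} (h : IsRealData σ p A B) (x t : ℝ) :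
    IsRealData σ p (planeWave A p x t) (planeWave B (-p) x t) := by
  intro i
  obtain ⟨h1, h2, h3⟩ := h i
  refine ⟨h1, ?_, ?_⟩
  · simp only [_root_.planeWave, h1, h2, map_mul, ← Complex.exp_conj, map_sub, map_pow,
      Complex.conj_ofReal, map_ofNat]
  · simp only [_root_.planeWave, h1, h3, map_mul, ← Complex.exp_conj, map_sub, map_pow,
      Complex.conj_ofReal, map_ofNat, Pi.neg_apply, map_neg, neg_mul]

/-- Conjugating row i gives row σ i of the alternant with -m; reordering the rows costs the sign of
σ. -/
theorem IsRealData.conj_altDet {σ : Equiv.Perm (Fin N)} (h : IsRealData σ p A B) :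
    conj (altDet p A B) = ((Equiv.Perm.sign σ : ℤ) : ℂ) * altDet p A (-B) := by
  unfold altDet
  rw [← Matrix.det_permute, RingHom.map_det]
  congr 1
  ext i k
  obtain ⟨h1, h2, h3⟩ := h i
  simp only [RingHom.mapMatrix_apply, Matrix.map_apply, Matrix.of_apply, altEntry,
    Matrix.submatrix_apply, id, Pi.neg_apply, h1, h2, h3, map_add, map_mul, map_pow, map_neg,
    neg_neg]

/-- The phase of a positive multiple of an alternant of real data. -/
theorem IsRealData.isPhase {σ : Equiv.Perm (Fin N)} (h : IsRealData σ p A B) {r θ : ℝ}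
    (hθ : IsPotentialValue (Complex.exp r * altDet p A B) θ) :
    IsPhase (Equiv.Perm.sign σ) p A B θ := by
  obtain ⟨h1, h2⟩ := hθ
  have hs := units_cast_mul_self (Equiv.Perm.sign σ)
  have hW : altDet p A B ≠ 0 := right_ne_zero_of_mul h1
  have hc := h.conj_altDet
  have hW' : altDet p A (-B) ≠ 0 := by
    intro h0
    rw [h0, mul_zero, map_eq_zero] at hc
    exact hW hc
  refine ⟨⟨hW, hW'⟩, ?_⟩
  rw [map_mul, ← Complex.exp_conj, Complex.conj_ofReal,
    mul_div_mul_left _ _ (Complex.exp_ne_zero _), hc] at h2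
  rw [Complex.exp_neg, h2, inv_div, altRatio, ← mul_div_assoc, ← mul_assoc, hs, one_mul]

/-- The new index is a fixed point, so the sign survives. This matters because the Bäcklund
relations need old and new ratios to carry the same sign. -/
theorem IsRealData.exists_append {p A B : Fin (N + 1) → ℂ} {σ : Equiv.Perm (Fin N)}
    (h : IsRealData σ (fun i : Fin N => p i.castSucc) (fun i => A i.castSucc)
      (fun i => B i.castSucc))
    (hp : (p (Fin.last N)).im = 0) (hA : (A (Fin.last N)).im = 0)
    (hB : (B (Fin.last N)).re = 0) :
    ∃ σ' : Equiv.Perm (Fin (N + 1)), Equiv.Perm.sign σ' = Equiv.Perm.sign σ ∧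
      IsRealData σ' p A B := by
  refine ⟨(finSuccEquivLast (n := N)).symm.permCongr (Equiv.optionCongr σ), ?_, ?_⟩
  · rw [Equiv.Perm.sign_permCongr, Equiv.optionCongr_sign]
  · intro i
    refine Fin.lastCases ?_ (fun i => ?_) i
    · simp only [Equiv.permCongr_apply, Equiv.symm_symm, finSuccEquivLast_last,
        Equiv.optionCongr_apply, Option.map_none, finSuccEquivLast_symm_none]
      exact ⟨(Complex.conj_eq_iff_im.2 hp).symm, (Complex.conj_eq_iff_im.2 hA).symm,
        Complex.ext (by simp [hB]) (by simp)⟩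
    · simp only [Equiv.permCongr_apply, Equiv.symm_symm, finSuccEquivLast_castSucc,
        Equiv.optionCongr_apply, Option.map_some, finSuccEquivLast_symm_some]
      exact h i

end Reality

/-! ### The tau function as an alternant of plane waves -/

theorem indefProd_succ {u : ℤ → ℂ} (hu : ∀ j, u j ≠ 0) (n : ℤ) :
    indefProd u (n + 1) = indefProd u n * u n := by
  unfold indefProd
  rcases lt_or_ge n 0 with hn | hn
  · have h1 : Finset.Ico 0 n = ∅ := Finset.Ico_eq_empty (by omega)
    have h2 : Finset.Ico 0 (n + 1) = ∅ := Finset.Ico_eq_empty (by omega)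
    have h3 : Finset.Ico n 0 = insert n (Finset.Ico (n + 1) 0) := by
      ext j; simp only [Finset.mem_Ico, Finset.mem_insert]; omega
    have h4 : (∏ j ∈ Finset.Ico (n + 1) 0, u j) ≠ 0 := Finset.prod_ne_zero_iff.2 fun j _ => hu j
    rw [h1, h2, h3, Finset.prod_insert (by simp)]
    have := hu n
    field_simp
  · have h1 : Finset.Ico n 0 = ∅ := Finset.Ico_eq_empty (by omega)
    have h2 : Finset.Ico (n + 1) 0 = ∅ := Finset.Ico_eq_empty (by omega)
    have h3 : Finset.Ico 0 (n + 1) = insert n (Finset.Ico 0 n) := by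
      ext j; simp only [Finset.mem_Ico, Finset.mem_insert]; omega
    rw [h1, h2, h3, Finset.prod_insert (by simp)]
    simp [mul_comm]

theorem indefProd_inv_succ_mul {v : ℤ → ℂ} (hv : ∀ j, v j ≠ 0) (n : ℤ) :
    indefProd (fun j => (v j)⁻¹) (n + 1) * v n = indefProd (fun j => (v j)⁻¹) n := by
  rw [indefProd_succ fun j => inv_ne_zero (hv j), inv_mul_cancel_right₀ (hv n)]

theorem conj_indefProd (u : ℤ → ℂ) (n : ℤ) :
    conj (indefProd u n) = indefProd (fun j => conj (u j)) n := by
  simp only [indefProd, map_div₀, map_prod]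

namespace TauData

variable (P : TauData) (N : ℕ)

/-- The spectral parameters `p_1, …, p_N`. -/
def spec (i : Fin N) : ℂ := P.p (i + 1)

/-- The amplitudes of the exponentials `e^{η_i}` at `x = t = 0`. -/
noncomputable def ampE (k l : ℤ) (y : ℝ) (n m : ℤ) (i : Fin N) : ℂ :=
  P.expTerm (P.α (i + 1)) (P.p (i + 1)) 0 k l n m 0 0 y

/-- The amplitudes of the exponentials `e^{μ_i}` at `x = t = 0`. -/
noncomputable def ampM (k l : ℤ) (y : ℝ) (n m : ℤ) (i : Fin N) : ℂ :=
  P.expTerm (P.β (i + 1)) (-P.p (i + 1)) 0 k l n m 0 0 y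

theorem expTerm_eq (A q : ℂ) (j : ℕ) (k l n m : ℤ) (x t y : ℝ) :
    P.expTerm A q (j : ℤ) k l n m x t y =
      P.expTerm A q 0 k l n m 0 0 y * Complex.exp (q * x - 4 * q ^ 3 * t) * q ^ j := by
  unfold expTerm
  rw [Complex.exp_add, Complex.exp_add]
  simp
  ring

theorem conj_expTerm (A q : ℂ) (k l n m : ℤ) (y : ℝ) :
    conj (P.expTerm A q 0 k l n m 0 0 y) = P.expTerm (conj A) (conj q) 0 k l n m 0 0 y := by
  simp [expTerm, conj_indefProd, ← Complex.exp_conj]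

theorem expTerm_neg_left (A q : ℂ) (k l n m : ℤ) (y : ℝ) :
    P.expTerm (-A) q 0 k l n m 0 0 y = -P.expTerm A q 0 k l n m 0 0 y := by
  simp [expTerm]

/-- Only the reality of the prefactor's exponent is recorded, since the prefactor cancels in τ / τ*.
-/
theorem tau_eq (k l n m : ℤ) (x t y : ℝ) : ∃ r : ℝ, P.tau N k l n m x t y =
    Complex.exp r * altDet (P.spec N) (planeWave (P.ampE N k l y n m) (P.spec N) x t)
      (planeWave (P.ampM N k l y n m) (-P.spec N) x t) := by
  refine ⟨-(x + indefSum P.a n + indefSum P.b m + indefSum P.c k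
    + indefSum (fun j => 1 / P.d j) l) * y, ?_⟩
  rw [tau, altDet]
  congr 2
  ext i j
  simp only [Matrix.of_apply, entry, expTerm_eq, altEntry, planeWave, ampE, ampM, spec,
    Pi.neg_apply]

variable {P N}

theorem spec_ne_zero (hreg : ∀ i : Fin N, P.RegularAt (i + 1)) (i : Fin N) : P.spec N i ≠ 0 :=
  (hreg i).1

theorem isLatticeWave (hreg : ∀ i : Fin N, P.RegularAt (i + 1)) (k l : ℤ) (y : ℝ) :
    IsLatticeWave P.a P.b (P.spec N) (P.ampE N k l y) (P.ampM N k l y) := by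
  refine ⟨fun n m i => ?_, fun n m i => ?_⟩
  · have h := (hreg i).2.1
    refine ⟨?_, ?_, h n⟩
    · have := indefProd_inv_succ_mul (fun j => (h j).1) n
      simp only [ampE, expTerm, spec]
      rw [← this]; ring
    · have := indefProd_inv_succ_mul (v := fun j => 1 - (P.a j : ℂ) * -P.p (i + 1))
        (fun j => by simpa using (h j).2) n
      simp only [ampM, expTerm, spec]
      rw [← this]; ring
  · have h := (hreg i).2.2.1
    refine ⟨?_, ?_, h m⟩
    · have := indefProd_inv_succ_mul (fun j => (h j).1) m
      simp only [ampE, expTerm, spec]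
      rw [← this]; ring
    · have := indefProd_inv_succ_mul (v := fun j => 1 - (P.b j : ℂ) * -P.p (i + 1))
        (fun j => by simpa using (h j).2) m
      simp only [ampM, expTerm, spec]
      rw [← this]; ring

theorem isShift_k (hreg : ∀ i : Fin N, P.RegularAt (i + 1)) (k l : ℤ) (y : ℝ) (n m : ℤ) :
    IsShift (P.c k) (P.spec N) (P.ampE N k l y n m) (P.ampM N k l y n m)
      (P.ampE N (k + 1) l y n m) (P.ampM N (k + 1) l y n m) := fun i => by
  have h := (hreg i).2.2.2.1
  refine ⟨?_, ?_, h k⟩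
  · have := indefProd_inv_succ_mul (fun j => (h j).1) k
    simp only [ampE, expTerm, spec]
    rw [← this]; ring
  · have := indefProd_inv_succ_mul (v := fun j => 1 - (P.c j : ℂ) * -P.p (i + 1))
      (fun j => by simpa using (h j).2) k
    simp only [ampM, expTerm, spec]
    rw [← this]; ring

/-- A shift in the direction `l` is, up to a rescaling of the rows and a change of sign of the
amplitudes `M`, a shift with parameter `1 / d_l`. -/
theorem isShift_l (hd : ∀ l, P.d l ≠ 0) (hreg : ∀ i : Fin N, P.RegularAt (i + 1)) (k l : ℤ)
    (y : ℝ) (n m : ℤ) :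
    IsShift (1 / P.d l) (P.spec N) (P.ampE N k l y n m) (P.ampM N k l y n m)
      (fun i => -(P.d l / P.spec N i) * P.ampE N k (l + 1) y n m i)
      (fun i => -(P.d l / P.spec N i) * (-P.ampM N k (l + 1) y n m) i) := fun i => by
  have h := (hreg i).2.2.2.2
  have hp := (hreg i).1
  have hdl : (P.d l : ℂ) ≠ 0 := by exact_mod_cast hd l
  -- The two factors are converted with opposite signs; one common row factor is possible only if
  -- the sign of the second amplitude is flipped.
  have e1 : 1 - ((1 / P.d l : ℝ) : ℂ) * P.p (i + 1) =
      -(P.p (i + 1) / P.d l) * (1 - P.d l / P.p (i + 1)) := by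
    push_cast; field_simp; ring
  have e2 : 1 + ((1 / P.d l : ℝ) : ℂ) * P.p (i + 1) =
      (P.p (i + 1) / P.d l) * (1 + P.d l / P.p (i + 1)) := by
    push_cast; field_simp; ring
  simp only [spec]
  rw [e1, e2]
  refine ⟨?_, ?_, mul_ne_zero (neg_ne_zero.2 (div_ne_zero hp hdl)) (h l).1,
    mul_ne_zero (div_ne_zero hp hdl) (h l).2⟩
  · have := indefProd_inv_succ_mul (fun j => (h j).1) l
    simp only [ampE, expTerm]
    rw [← this]
    field_simp
  · have := indefProd_inv_succ_mul (v := fun j => 1 - (P.d j : ℂ) / -P.p (i + 1))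
      (fun j => by simpa [div_neg] using (h j).2) l
    have e3 : 1 - (P.d l : ℂ) / -P.p (i + 1) = 1 + P.d l / P.p (i + 1) := by
      rw [div_neg, sub_neg_eq_add]
    rw [e3] at this
    simp only [ampM, expTerm, Pi.neg_apply]
    rw [← this]
    field_simp

theorem isRealData_amp {σ : Equiv.Perm (Fin N)}
    (h : IsRealData σ (P.spec N) (fun i => P.α (i + 1)) (fun i => P.β (i + 1)))
    (k l : ℤ) (y : ℝ) (n m : ℤ) :
    IsRealData σ (P.spec N) (P.ampE N k l y n m) (P.ampM N k l y n m) := by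
  intro i
  obtain ⟨h1, h2, h3⟩ := h i
  simp only [spec] at h1 h2 h3
  refine ⟨h1, ?_, ?_⟩
  · simp only [ampE]
    rw [conj_expTerm, h1, h2]
  · simp only [ampM]
    rw [conj_expTerm, h1, h3, expTerm_neg_left, map_neg]

theorem SolitonParams.isRealData (h : P.SolitonParams N) :
    IsRealData 1 (P.spec N) (fun i => P.α (i + 1)) (fun i => P.β (i + 1)) := fun i => by
  obtain ⟨h1, h2, h3⟩ := h (i + 1) (by omega) (by omega)
  exact ⟨(Complex.conj_eq_iff_im.2 h1).symm, (Complex.conj_eq_iff_im.2 h2).symm,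
    Complex.ext (by simp [h3]) (by simp)⟩

theorem BreatherParams.exists_isRealData (h : P.BreatherParams N) :
    ∃ σ, IsRealData σ (P.spec N) (fun i => P.α (i + 1)) (fun i => P.β (i + 1)) := by
  obtain ⟨M, rfl, h⟩ := h
  -- Conjugation swaps p_{2j-1} and p_{2j}. With indices counted from 0 the pair is (i, i + 1) with
  -- i even.
  let f : Fin (2 * M) → Fin (2 * M) := fun i =>
    if hi : (i : ℕ) % 2 = 0 then ⟨i + 1, by omega⟩ else ⟨i - 1, by omega⟩
  have hf : Function.Involutive f := by
    have hv : ∀ i, (f i : ℕ) = if (i : ℕ) % 2 = 0 then (i : ℕ) + 1 else i - 1 := fun i => by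
      simp only [f]
      split_ifs <;> rfl
    intro i
    ext
    rw [hv, hv]
    split_ifs <;> omega
  refine ⟨hf.toPerm, fun i => ?_⟩
  rw [Function.Involutive.coe_toPerm]
  obtain ⟨h1, h2, h3⟩ := h (i / 2 + 1) (by omega) (by omega)
  simp only [spec, f]
  split_ifs with hi
  · have e1 : 2 * ((i : ℕ) / 2 + 1) = i + 1 + 1 := by omega
    have e2 : 2 * ((i : ℕ) / 2 + 1) - 1 = i + 1 := by omega
    rw [e2, e1] at h1 h2 h3
    exact ⟨h1, h2, h3⟩
  · have e1 : 2 * ((i : ℕ) / 2 + 1) = i + 1 := by omega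
    have e2 : 2 * ((i : ℕ) / 2 + 1) - 1 = i - 1 + 1 := by omega
    rw [e2, e1] at h1 h2 h3
    simp only
    rw [h1, h2, h3]
    simp

section Potential

variable {σ : Equiv.Perm (Fin N)}

theorem isFlowPhase (h : IsRealData σ (P.spec N) (fun i => P.α (i + 1)) (fun i => P.β (i + 1)))
    {k l n m : ℤ} {y : ℝ} {U : Set (ℝ × ℝ)} {θ : ℝ → ℝ → ℝ}
    (hθ : IsPotentialOn U (fun x t => P.tau N k l n m x t y) θ) :
    IsFlowPhase (Equiv.Perm.sign σ) (P.spec N) (P.ampE N k l y n m) (P.ampM N k l y n m) U θ := by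
  refine ⟨hθ.1, fun x t hxt => ?_⟩
  have h1 := hθ.2 x t hxt
  obtain ⟨r, hr⟩ := P.tau_eq N k l n m x t y
  simp only [hr] at h1
  exact ((isRealData_amp h k l y n m).planeWave x t).isPhase h1

theorem isLatticePhase (h : IsRealData σ (P.spec N) (fun i => P.α (i + 1)) (fun i => P.β (i + 1)))
    {k l : ℤ} {x t y : ℝ} {S : Set (ℤ × ℤ)} {Θ : ℤ → ℤ → ℝ}
    (hΘ : IsLatticePotentialOn S (fun n m => P.tau N k l n m x t y) Θ) :
    IsLatticePhase (Equiv.Perm.sign σ) (P.spec N)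
      (fun n m => planeWave (P.ampE N k l y n m) (P.spec N) x t)
      (fun n m => planeWave (P.ampM N k l y n m) (-P.spec N) x t) S Θ := by
  intro n m hnm
  have h1 := hΘ n m hnm
  obtain ⟨r, hr⟩ := P.tau_eq N k l n m x t y
  simp only [hr] at h1
  exact ((isRealData_amp h k l y n m).planeWave x t).isPhase h1

end Potential

end TauData

/-! ### Row factors with a sign flip, and the main theorem -/

/-- Brings potentials at l + 1 to the form that the shift with parameter 1 / d_l produces, at the
price of negating the potential. -/
theorem IsFlowPhase.mul_row_neg {N : ℕ} {s : ℤˣ} {p A B κ : Fin N → ℂ} {U : Set (ℝ × ℝ)}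
    {θ : ℝ → ℝ → ℝ} (hκ : ∀ i, κ i ≠ 0) (h : IsFlowPhase s p A B U θ) :
    IsFlowPhase s p (fun i => κ i * A i) (fun i => κ i * (-B) i) U fun x t => -θ x t :=
  ⟨h.neg.1, fun x t hxt => by
    rw [planeWave_mul_row, planeWave_mul_row]
    exact (h.neg.2 x t hxt).mul_row hκ⟩

theorem IsLatticePhase.mul_row_neg {N : ℕ} {s : ℤˣ} {p κ : Fin N → ℂ} {E M : ℤ → ℤ → Fin N → ℂ}
    {S : Set (ℤ × ℤ)} {Θ : ℤ → ℤ → ℝ} (hκ : ∀ i, κ i ≠ 0) (h : IsLatticePhase s p E M S Θ) :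
    IsLatticePhase s p (fun n m i => κ i * E n m i) (fun n m i => κ i * (-M n m) i) S
      fun n m => -Θ n m :=
  fun n m hnm => (h n m hnm).neg.mul_row hκ

theorem mainTheorem4 (P : TauData) (N : ℕ)
    (hc : ∀ k, P.c k ≠ 0) (hd : ∀ l, P.d l ≠ 0)
    (hreg : ∀ i, 1 ≤ i → i ≤ N → P.RegularAt i)
    (hreal : P.SolitonParams N ∨ P.BreatherParams N) :
    (∀ (k l n m : ℤ) (y : ℝ) (U : Set (ℝ × ℝ)) (θ θ' : ℝ → ℝ → ℝ), IsOpen U →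
      IsPotentialOn U (fun x t => P.tau N k l n m x t y) θ →
      IsPotentialOn U (fun x t => P.tau N (k + 1) l n m x t y) θ' →
      PmKdVBacklund U (1 / P.c k) θ θ') ∧
    (∀ (k l : ℤ) (x t y : ℝ) (S : Set (ℤ × ℤ)) (Θ Θ' : ℤ → ℤ → ℝ),
      IsLatticePotentialOn S (fun n m => P.tau N k l n m x t y) Θ →
      IsLatticePotentialOn S (fun n m => P.tau N (k + 1) l n m x t y) Θ' →
      DpmKdVBacklund S P.a P.b (1 / P.c k) Θ Θ') ∧
    (P.SolitonAt (N + 1) → P.RegularAt (N + 1) →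
      ∀ (k l n m : ℤ) (y : ℝ) (U : Set (ℝ × ℝ)) (θ θ' : ℝ → ℝ → ℝ), IsOpen U →
      IsPotentialOn U (fun x t => P.tau N k l n m x t y) θ →
      IsPotentialOn U (fun x t => P.tau (N + 1) k l n m x t y) θ' →
      PmKdVBacklund U (-(P.p (N + 1)).re) θ θ') ∧
    (P.SolitonAt (N + 1) → P.RegularAt (N + 1) →
      ∀ (k l : ℤ) (x t y : ℝ) (S : Set (ℤ × ℤ)) (Θ Θ' : ℤ → ℤ → ℝ),
      IsLatticePotentialOn S (fun n m => P.tau N k l n m x t y) Θ →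
      IsLatticePotentialOn S (fun n m => P.tau (N + 1) k l n m x t y) Θ' →
      DpmKdVBacklund S P.a P.b (-(P.p (N + 1)).re) Θ Θ') ∧
    (∀ (k l n m : ℤ) (y : ℝ) (U : Set (ℝ × ℝ)) (θ θ' : ℝ → ℝ → ℝ), IsOpen U →
      IsPotentialOn U (fun x t => P.tau N k l n m x t y) θ →
      IsPotentialOn U (fun x t => P.tau N k (l + 1) n m x t y) θ' →
      PmKdVBacklundBar U (P.d l) θ θ') ∧
    (∀ (k l : ℤ) (x t y : ℝ) (S : Set (ℤ × ℤ)) (Θ Θ' : ℤ → ℤ → ℝ),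
      IsLatticePotentialOn S (fun n m => P.tau N k l n m x t y) Θ →
      IsLatticePotentialOn S (fun n m => P.tau N k (l + 1) n m x t y) Θ' →
      DpmKdVBacklundBar S P.a P.b (P.d l) Θ Θ') := by
  have hreg' : ∀ i : Fin N, P.RegularAt (i + 1) := fun i => hreg _ (by omega) (by omega)
  obtain ⟨σ, hσ⟩ : ∃ σ, IsRealData σ (P.spec N) (fun i => P.α (i + 1)) (fun i => P.β (i + 1)) :=
    hreal.elim (fun h => ⟨1, h.isRealData⟩) fun h => h.exists_isRealData
  have hp := TauData.spec_ne_zero hreg'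
  have happ : P.SolitonAt (N + 1) → P.RegularAt (N + 1) →
      (∀ i : Fin (N + 1), P.RegularAt (i + 1)) ∧
      P.spec (N + 1) (Fin.last N) = (P.p (N + 1)).re ∧
      ∃ σ' : Equiv.Perm (Fin (N + 1)), Equiv.Perm.sign σ' = Equiv.Perm.sign σ ∧
        IsRealData σ' (P.spec (N + 1)) (fun i => P.α (i + 1)) (fun i => P.β (i + 1)) :=
    fun hs hr => ⟨fun i => Fin.lastCases hr (fun i => hreg' i) i,
      Complex.ext rfl (hs.1.trans (Complex.ofReal_im _).symm), IsRealData.exists_append hσ hs.1 hs.2.1 hs.2.2⟩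
  have hκ : ∀ l i, -((P.d l : ℂ) / P.spec N i) ≠ 0 := fun l i =>
    neg_ne_zero.2 (div_ne_zero (by exact_mod_cast hd l) (hp i))
  refine ⟨?_, ?_, ?_, ?_, ?_, ?_⟩
  · intro k l n m y U θ θ' hU h h'
    exact (TauData.isFlowPhase hσ h).backlund_of_shift hp hU (hc k)
      (TauData.isShift_k hreg' k l y n m) (TauData.isFlowPhase hσ h')
  · intro k l x t y S Θ Θ' h h'
    exact (TauData.isLatticePhase hσ h).backlund_of_shift hp (hc k)
      ((TauData.isLatticeWave hreg' k l y).planeWave x t)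
      ((TauData.isLatticeWave hreg' (k + 1) l y).planeWave x t)
      (fun n m => (TauData.isShift_k hreg' k l y n m).planeWave x t)
      (TauData.isLatticePhase hσ h')
  · intro hs hr k l n m y U θ θ' hU h h'
    obtain ⟨hreg₁, hq, σ', hsign, hσ'⟩ := happ hs hr
    have h₁ := TauData.isFlowPhase hσ' h'
    rw [hsign] at h₁
    -- The data of N rows are, by definition, the first N rows of the data of N + 1 rows.
    have h₀ : IsFlowPhase (Equiv.Perm.sign σ) (fun i : Fin N => P.spec (N + 1) i.castSucc)
        (fun i => P.ampE (N + 1) k l y n m i.castSucc)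
        (fun i => P.ampM (N + 1) k l y n m i.castSucc) U θ := TauData.isFlowPhase hσ h
    exact IsFlowPhase.backlund_of_append (TauData.spec_ne_zero hreg₁) hU hq h₀ h₁
  · intro hs hr k l x t y S Θ Θ' h h'
    obtain ⟨hreg₁, hq, σ', hsign, hσ'⟩ := happ hs hr
    have h₁ := TauData.isLatticePhase hσ' h'
    rw [hsign] at h₁
    have h₀ : IsLatticePhase (Equiv.Perm.sign σ) (fun i : Fin N => P.spec (N + 1) i.castSucc)
        (fun n m i => planeWave (P.ampE (N + 1) k l y n m) (P.spec (N + 1)) x t i.castSucc)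
        (fun n m i => planeWave (P.ampM (N + 1) k l y n m) (-P.spec (N + 1)) x t i.castSucc)
        S Θ := TauData.isLatticePhase hσ h
    exact IsLatticePhase.backlund_of_append (TauData.spec_ne_zero hreg₁) hq
      ((TauData.isLatticeWave hreg₁ k l y).planeWave x t) h₀ h₁
  · intro k l n m y U θ θ' hU h h'
    have h₁ := TauData.isFlowPhase hσ h'
    -- This is a transformation of the first kind from θ to -θ' with λ = 1 / (1 / d_l) = d_l;
    -- negating the new potential back gives the second kind.
    have h₂ := (TauData.isFlowPhase hσ h).backlund_of_shift hp hU
      (one_div_ne_zero (hd l)) (TauData.isShift_l hd hreg' k l y n m) (h₁.mul_row_neg (hκ l))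
    rw [one_div_one_div] at h₂
    exact h₂.bar (h₁.solvesPmKdV hp hU)
  · intro k l x t y S Θ Θ' h h'
    have h₁ := TauData.isLatticePhase hσ h'
    have hw := (TauData.isLatticeWave hreg' k (l + 1) y).planeWave x t
    have h₂ := (TauData.isLatticePhase hσ h).backlund_of_shift hp (one_div_ne_zero (hd l))
      ((TauData.isLatticeWave hreg' k l y).planeWave x t) hw.mul_row_neg (fun n m => by
        have := (TauData.isShift_l hd hreg' k l y n m).planeWave x t
        rwa [planeWave_mul_row, planeWave_mul_row, planeWave_neg] at this)
      (h₁.mul_row_neg (hκ l))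
    rw [one_div_one_div] at h₂
    exact h₂.bar (h₁.solvesDpmKdV hp hw)
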